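/- **Setting.** Let $\Sigma$ be the brick-wall drawing of the honeycomb lattice in the plane: its vertex set is $V=\mathbb Z^2\subset\mathbb R^2$, its edges are all horizontal unit segments between lattice points and the vertical unit segments whose lower end $(x,y)$ has $x+y$ odd, and its faces are the $2\times 1$ bricks with lower left corner $(a,b)$, $a+b$ odd. Each face $f$ has six vertices $\partial f=\{a,a+1,a+2\}\times\{b,b+1\}$, and is colored $\mathtt r,\mathtt g,\mathtt b$ according to $a \bmod 3$, so that adjacent faces have different colors. An edge connects the faces $f,g$ if it leaves $f$ at one of its ends and arrives in $g$ at the other. Let $\mathcal A$ be the quasi-local $C^*$-algebra with one qubit $M_2(\mathbb C)$ at each vertex, i.e. the norm completion of $\bigcup_{\Lambda}\bigotimes_{v\in\Lambda}M_2(\mathbb C)$ over finite $\Lambda\subset V$, and for $\Lambda\subset V$ let $\mathcal A(\Lambda)$ be the closed subalgebra generated by the observables at the vertices of $\Lambda$. For a face $f$ put $K_f=\prod_{v\in\partial f}\sigma^{\mathtt x}_v$ and $J_f=\prod_{v\in\partial f}\sigma^{\mathtt z}_v$. Let $\omega_0$ be a state on $\mathcal A$ with $\omega_0(K_f)=\omega_0(J_f)=1$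 for all faces $f$ (the ground state of the color code), and let $\pi_0$ be its GNS representation. For $c\in\{\mathtt r,\mathtt g,\mathtt b\}$, a half-infinite string of color $c$ starting at $f_0$ is a sequence $\gamma=(f_0,v_0,v_1,f_1,v_2,v_3,f_2,\dots)$ of $c$-colored faces $f_i$ and vertices such that $v_{2i}v_{2i+1}$ is an edge leaving $f_i$ at $v_{2i}$ and arriving in $f_{i+1}$ at $v_{2i+1}$, and such that each vertex occurs only finitely often. Let $\gamma_n$ be its part formed by the first $n$ faces and the vertices between them, and put $S^{c\mathtt x}_{\gamma_n}=\prod_{v_j\in\gamma_n}\sigma^{\mathtt x}_{v_j}$, $S^{c\mathtt z}_{\gamma_n}=\prod_{v_j\in\gamma_n}\sigma^{\mathtt z}_{v_j}$, $S^{c\mathtt y}_{\gamma_n}=S^{c\mathtt x}_{\gamma_n}S^{c\mathtt z}_{\gamma_n}$. For $k\in\{\mathtt x,\mathtt y,\mathtt z\}$ let $\rho^{ck}_\gamma(A)=\lim_n (S^{ck}_{\gamma_n})^*AS^{ck}_{\gamma_n}$ (norm limit), a unital $*$-endomorphism of $\mathcal A$. A cone is a set of vertices $\Lambda=\{v\in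 V: (v-p)\cdot a>\|v-p\|\cos\theta\}$ with $p\in\mathbb R^2$, $a$ a unit vector and $\theta\in(0,\pi)$; $\Lambda^c=V\setminus\Lambda$. The symbol $\simeq$ denotes unitary equivalence of representations. **Theorem.** The state $\omega_0$ exists and is unique. Each face is the starting face of a half-infinite string of its color, and for a half-infinite string $\gamma$ of color $c$ the state $\omega_f^{ck}=\omega_0\circ\rho^{ck}_\gamma$ depends only on $c,k$ and the starting face $f$ of $\gamma$. Let $\pi^{ck}_f$ be the GNS representation of $\omega_f^{ck}$. Then: 1. $\pi^{ck}_f$ satisfies the superselection criterion: $\pi_f^{ck}|_{\mathcal A(\Lambda^c)}\simeq\pi_0|_{\mathcal A(\Lambda^c)}$ for every cone $\Lambda$, all $c,k$ and all $c$-colored faces $f$. 2. $\pi_f^{ck}\simeq\pi_{f'}^{ck}$ for all $c$-colored faces $f,f'$. 3. $\pi_f^{ck}\simeq\pi_{f'}^{c'k'}$ if and only if $c=c'$ and $k=k'$. In particular the $\pi^{ck}_f$ fall into exactly nine unitary equivalence classes. -/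

import Mathlib

namespace ColorCode
open scoped ComplexOrder InnerProductSpace
open Filter Topology
noncomputable section

/-- The vertices of the brick-wall drawing of the honeycomb lattice: all integer points of the plane. -/
abbrev Vertex : Type := ℤ × ℤ
/-- Basis configurations of the qubits: all but finitely many qubits are in state `0`. -/
abbrev Config : Type := Vertex →₀ Fin 2
/-- The reference Hilbert space: the infinite tensor product of the qubit spaces `ℂ²` along the
vector `|0⟩ ⊗ |0⟩ ⊗ ⋯`, with orthonormal basis indexed by the configurations. -/
abbrev RefSpace : Type := lp (fun _ : Config => ℂ) 2

/-- The involution exchanging the value at `v` with an external qubit value. -/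
def swapEquiv (v : Vertex) : Config × Fin 2 ≃ Config × Fin 2 where
  toFun p := (p.1.update v p.2, p.1 v)
  invFun p := (p.1.update v p.2, p.1 v)
  left_inv p := by ext w <;> simp [Finsupp.update_apply]
  right_inv p := by ext w <;> simp [Finsupp.update_apply]

theorem summable_sq (ψ : RefSpace) : Summable fun s : Config => ‖ψ s‖ ^ 2 := by
  simpa using (lp.memℓp ψ).summable (by norm_num)

theorem norm_sq_eq (ψ : RefSpace) : ‖ψ‖ ^ 2 = ∑' s : Config, ‖ψ s‖ ^ 2 := by
  simpa using lp.norm_rpow_eq_tsum (p := 2) (by norm_num) ψ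

theorem hasSum_prod_sq (ψ : RefSpace) :
    HasSum (fun p : Config × Fin 2 => ‖ψ p.1‖ ^ 2) (2 * ‖ψ‖ ^ 2) := by
  have hs : Summable (fun p : Config × Fin 2 => ‖ψ p.1‖ ^ 2) := by
    refine (summable_prod_of_nonneg (fun p => by positivity)).2
      ⟨fun _ => (hasSum_fintype _).summable, ?_⟩
    simpa using (summable_sq ψ).mul_left 2
  have := hs.hasSum
  rw [hs.tsum_prod] at this
  simpa [tsum_mul_left, norm_sq_eq ψ] using this

theorem hasSum_update (v : Vertex) (ψ : RefSpace) :
    HasSum (fun s : Config => ∑ j : Fin 2, ‖ψ (s.update v j)‖ ^ 2) (2 * ‖ψ‖ ^ 2) :=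
  ((swapEquiv v).hasSum_iff.2 (hasSum_prod_sq ψ)).prod_fiberwise fun s => hasSum_fintype _

theorem siteFun_bound (v : Vertex) (M : Matrix (Fin 2) (Fin 2) ℂ) (ψ : RefSpace) (s : Config) :
    ‖∑ j, M (s v) j * ψ (s.update v j)‖ ^ 2 ≤
      (∑ i, ∑ j, ‖M i j‖ ^ 2) * ∑ j : Fin 2, ‖ψ (s.update v j)‖ ^ 2 := by
  calc _ ≤ (∑ j, ‖M (s v) j‖ * ‖ψ (s.update v j)‖) ^ 2 := by
        gcongr
        exact (norm_sum_le _ _).trans_eq (by simp)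
    _ ≤ (∑ j, ‖M (s v) j‖ ^ 2) * ∑ j : Fin 2, ‖ψ (s.update v j)‖ ^ 2 :=
        Finset.sum_mul_sq_le_sq_mul_sq _ _ _
    _ ≤ _ := by
        refine mul_le_mul_of_nonneg_right ?_ (by positivity)
        exact Finset.single_le_sum (f := fun i => ∑ j, ‖M i j‖ ^ 2)
          (fun i _ => by positivity) (Finset.mem_univ _)

theorem siteFun_summable (v : Vertex) (M : Matrix (Fin 2) (Fin 2) ℂ) (ψ : RefSpace) :
    Summable fun s : Config => ‖∑ j, M (s v) j * ψ (s.update v j)‖ ^ 2 :=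
  .of_nonneg_of_le (fun _ => by positivity) (siteFun_bound v M ψ)
    ((hasSum_update v ψ).summable.mul_left _)

/-- The action of a `2 × 2` matrix on the qubit at `v`. -/
def siteLin (v : Vertex) (M : Matrix (Fin 2) (Fin 2) ℂ) : RefSpace →ₗ[ℂ] RefSpace where
  toFun ψ := ⟨fun s => ∑ j, M (s v) j * ψ (s.update v j),
    memℓp_gen (by simpa using siteFun_summable v M ψ)⟩
  map_add' ψ φ := by
    ext s
    simp only [lp.coeFn_add, Pi.add_apply, Fin.sum_univ_two]
    ring
  map_smul' a ψ := by
    ext s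
    simp
    try ring

theorem siteLin_apply (v : Vertex) (M : Matrix (Fin 2) (Fin 2) ℂ) (ψ : RefSpace) (s : Config) :
    siteLin v M ψ s = ∑ j, M (s v) j * ψ (s.update v j) := rfl

theorem siteLin_bound (v : Vertex) (M : Matrix (Fin 2) (Fin 2) ℂ) (ψ : RefSpace) :
    ‖siteLin v M ψ‖ ≤ √((∑ i, ∑ j, ‖M i j‖ ^ 2) * 2) * ‖ψ‖ := by
  have h0 : 0 ≤ ∑ i, ∑ j, ‖M i j‖ ^ 2 := by positivity
  refine (sq_le_sq₀ (by positivity) (by positivity)).1 ?_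
  rw [mul_pow, Real.sq_sqrt (by positivity), norm_sq_eq, mul_assoc,
    ← (hasSum_update v ψ).tsum_eq, ← tsum_mul_left]
  exact (siteFun_summable v M ψ).tsum_le_tsum (siteFun_bound v M ψ)
    ((hasSum_update v ψ).summable.mul_left _)

/-- `siteLin` as a bounded operator. -/
def siteCLM (v : Vertex) (M : Matrix (Fin 2) (Fin 2) ℂ) : RefSpace →L[ℂ] RefSpace :=
  (siteLin v M).mkContinuous _ (siteLin_bound v M)

theorem siteCLM_apply (v : Vertex) (M : Matrix (Fin 2) (Fin 2) ℂ) (ψ : RefSpace) (s : Config) :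
    siteCLM v M ψ s = ∑ j, M (s v) j * ψ (s.update v j) := rfl

theorem update_same (s : Config) (v : Vertex) (i : Fin 2) : (s.update v i) v = i := by
  simp

theorem update_twice (s : Config) (v : Vertex) (i j : Fin 2) :
    (s.update v i).update v j = s.update v j := by
  ext w; simp [Finsupp.update_apply]

theorem siteCLM_inner (v : Vertex) (M : Matrix (Fin 2) (Fin 2) ℂ) (ψ φ : RefSpace) :
    ⟪siteCLM v (star M) ψ, φ⟫_ℂ = ⟪ψ, siteCLM v M φ⟫_ℂ := by
  set G : Config × Fin 2 → ℂ := fun p =>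
    M (p.1 v) p.2 * φ (p.1.update v p.2) * (starRingEnd ℂ) (ψ p.1) with hG
  have hsum : Summable G := by
    have h1 := ((swapEquiv v).hasSum_iff.2 (hasSum_prod_sq φ)).summable
    have h2 := (hasSum_prod_sq ψ).summable
    refine .of_norm_bounded ((h1.add h2).mul_left (∑ i, ∑ j, ‖M i j‖)) fun p => ?_
    have hM : ‖M (p.1 v) p.2‖ ≤ ∑ i, ∑ j, ‖M i j‖ :=
      (Finset.single_le_sum (f := fun j => ‖M (p.1 v) j‖)
        (fun j _ => norm_nonneg _) (Finset.mem_univ p.2)).trans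
      (Finset.single_le_sum (f := fun i => ∑ j, ‖M i j‖)
        (fun i _ => by positivity) (Finset.mem_univ (p.1 v)))
    simp only [hG, norm_mul, RCLike.norm_conj, mul_assoc]
    refine mul_le_mul hM ?_ (by positivity) (by positivity)
    change ‖φ (p.1.update v p.2)‖ * ‖ψ p.1‖ ≤ ‖φ (p.1.update v p.2)‖ ^ 2 + ‖ψ p.1‖ ^ 2
    nlinarith [sq_nonneg (‖φ (p.1.update v p.2)‖ - ‖ψ p.1‖),
      sq_nonneg (‖φ (p.1.update v p.2)‖), sq_nonneg (‖ψ p.1‖)]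
  have h1 := hsum.hasSum.prod_fiberwise fun s => hasSum_fintype _
  have h2 := ((swapEquiv v).hasSum_iff.2 hsum.hasSum).prod_fiberwise fun s => hasSum_fintype _
  rw [lp.inner_eq_tsum, lp.inner_eq_tsum]
  refine Eq.trans ?_ (h2.tsum_eq.trans (h1.tsum_eq.symm.trans ?_))
  · refine tsum_congr fun s => ?_
    simp [siteCLM_apply, hG, swapEquiv, Matrix.star_apply]
    ring
  · refine tsum_congr fun s => ?_
    simp [siteCLM_apply, hG]
    ring

/-- The observables `M₂(ℂ)` of the qubit at `v`, acting on the tensor factor at `v`: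
`(M_v ψ)(s) = ∑ j, M (s v) j * ψ (s[v := j])`. -/
def siteOp (v : Vertex) : Matrix (Fin 2) (Fin 2) ℂ →⋆ₐ[ℂ] (RefSpace →L[ℂ] RefSpace) where
  toFun := siteCLM v
  map_one' := by
    ext ψ s
    simp [siteCLM_apply, Matrix.one_apply]
  map_mul' M N := by
    ext ψ s
    simp only [mul_apply_eq_comp, siteCLM_apply, update_same, update_twice,
      Matrix.mul_apply, Fin.sum_univ_two]
    ring
  map_zero' := by
    ext ψ s
    simp [siteCLM_apply]
  map_add' M N := by
    ext ψ s
    simp [siteCLM_apply, add_mul, Finset.sum_add_distrib]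
    try ring
  commutes' a := by
    ext ψ s
    simp [siteCLM_apply, Matrix.algebraMap_matrix_apply]
  map_star' M := by
    refine (ContinuousLinearMap.eq_adjoint_iff _ _).2 fun ψ φ => ?_
    exact siteCLM_inner v M ψ φ

theorem siteOp_apply (v : Vertex) (M : Matrix (Fin 2) (Fin 2) ℂ) (ψ : RefSpace) (s : Config) :
    siteOp v M ψ s = ∑ j, M (s v) j * ψ (s.update v j) := rfl

theorem siteOp_comm {v w : Vertex} (h : v ≠ w) (M N : Matrix (Fin 2) (Fin 2) ℂ) :
    siteOp v M * siteOp w N = siteOp w N * siteOp v M := by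
  ext ψ s
  have hu : ∀ i j : Fin 2, (s.update v i).update w j = (s.update w j).update v i := by
    intro i j
    ext x
    by_cases h1 : x = v <;> by_cases h2 : x = w <;> simp_all [Finsupp.update_apply]
  have hw : ∀ i : Fin 2, (s.update v i) w = s w := fun i => by
    simp [Finsupp.update_apply, h.symm]
  have hv : ∀ i : Fin 2, (s.update w i) v = s v := fun i => by
    simp [Finsupp.update_apply, h]
  simp only [mul_apply_eq_comp, siteOp_apply, hu, hv, hw, Fin.sum_univ_two]
  ring


/-- The quasi-local algebra: the norm closure of the local observables. Local observables are
the algebra generated by the commuting copies `siteOp v` of `M₂(ℂ)`, so the part generated by the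
sites of a finite set `Λ` is `⨂_{v ∈ Λ} M₂(ℂ)`; this algebra acts faithfully on the reference
space, hence isometrically, and the norm closure is the C⋆-inductive limit. -/
def QuasiLocal : Type :=
  ↥(StarAlgebra.adjoin ℂ {T | ∃ (v : Vertex) (M : Matrix (Fin 2) (Fin 2) ℂ),
    T = siteOp v M}).topologicalClosure

/-- The quasi-local algebra is a C⋆-algebra, being closed in the bounded operators. -/
def QuasiLocal.cstarAlgebra : CStarAlgebra QuasiLocal :=
  StarSubalgebra.cstarAlgebra
    (h_closed := StarSubalgebra.isClosed_topologicalClosure _) _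

instance : CStarAlgebra QuasiLocal := QuasiLocal.cstarAlgebra

/-- The order whose positive elements are the elements `star a * a`. -/
instance : PartialOrder QuasiLocal := CStarAlgebra.spectralOrder QuasiLocal

instance : StarOrderedRing QuasiLocal := CStarAlgebra.spectralOrderedRing QuasiLocal

/-- The inclusion of the quasi-local algebra into the bounded operators. -/
def toOp : QuasiLocal →⋆ₐ[ℂ] (RefSpace →L[ℂ] RefSpace) :=
  StarSubalgebra.subtype _

theorem siteOp_mem (v : Vertex) (M : Matrix (Fin 2) (Fin 2) ℂ) :
    siteOp v M ∈ (StarAlgebra.adjoin ℂ {T | ∃ (v : Vertex) (M : Matrix (Fin 2) (Fin 2) ℂ),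
      T = siteOp v M}).topologicalClosure :=
  StarSubalgebra.le_topologicalClosure _ (StarAlgebra.subset_adjoin ℂ _ ⟨v, M, rfl⟩)

/-- The observables of the qubit at `v` inside the quasi-local algebra. -/
def site (v : Vertex) : Matrix (Fin 2) (Fin 2) ℂ →⋆ₐ[ℂ] QuasiLocal :=
  StarAlgHom.codRestrict (siteOp v) _ (siteOp_mem v)

/-- The union of the algebras `𝒜(Λ')` over the finite subsets `Λ'` of `Λ`. -/
def strictlyLocalAlgebra (Λ : Set Vertex) : StarSubalgebra ℂ QuasiLocal :=
  StarAlgebra.adjoin ℂ {a | ∃ v ∈ Λ, ∃ M : Matrix (Fin 2) (Fin 2) ℂ, a = site v M}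

/-- The algebra `𝒜(Λ)` of observables localized in `Λ`. -/
def localAlgebra (Λ : Set Vertex) : StarSubalgebra ℂ QuasiLocal :=
  (strictlyLocalAlgebra Λ).topologicalClosure

theorem toOp_injective : Function.Injective toOp := Subtype.val_injective

theorem isometry_toOp : Isometry toOp := isometry_subtype_coe

theorem toOp_site (v : Vertex) (M : Matrix (Fin 2) (Fin 2) ℂ) : toOp (site v M) = siteOp v M := rfl

theorem site_comm {v w : Vertex} (h : v ≠ w) (M N : Matrix (Fin 2) (Fin 2) ℂ) :
    site v M * site w N = site w N * site v M :=
  toOp_injective (by simpa [toOp_site] using siteOp_comm h M N)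

theorem localAlgebra_univ : localAlgebra Set.univ = ⊤ := by
  refine eq_top_iff.2 fun a _ => ?_
  change a ∈ closure (strictlyLocalAlgebra Set.univ : Set QuasiLocal)
  refine Metric.mem_closure_iff.2 fun ε hε => ?_
  have ha : toOp a ∈ closure ((StarAlgebra.adjoin ℂ
      {T | ∃ (v : Vertex) (M : Matrix (Fin 2) (Fin 2) ℂ), T = siteOp v M} :
        StarSubalgebra ℂ (RefSpace →L[ℂ] RefSpace)) : Set (RefSpace →L[ℂ] RefSpace)) := a.2
  obtain ⟨T, hT, hd⟩ := Metric.mem_closure_iff.1 ha ε hε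
  have hmap : (strictlyLocalAlgebra Set.univ).map toOp = StarAlgebra.adjoin ℂ
      {T | ∃ (v : Vertex) (M : Matrix (Fin 2) (Fin 2) ℂ), T = siteOp v M} := by
    rw [strictlyLocalAlgebra, StarAlgHom.map_adjoin]
    congr 1
    ext T
    constructor
    · rintro ⟨_, ⟨v, -, M, rfl⟩, rfl⟩
      exact ⟨v, M, rfl⟩
    · rintro ⟨v, M, rfl⟩
      exact ⟨site v M, ⟨v, trivial, M, rfl⟩, rfl⟩
  rw [← hmap] at hT
  obtain ⟨b, hb, rfl⟩ := hT
  exact ⟨b, hb, by rwa [← isometry_toOp.dist_eq]⟩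

/-- The three colors. -/
inductive Color | r | g | b

/-- The three Pauli types. -/
inductive Pauli | x | y | z

def sigmaX : Matrix (Fin 2) (Fin 2) ℂ := !![0, 1; 1, 0]
def sigmaZ : Matrix (Fin 2) (Fin 2) ℂ := !![1, 0; 0, -1]

/-- The product of the matrix `M` placed on the vertices of the list. -/
def siteProd (M : Matrix (Fin 2) (Fin 2) ℂ) (l : List Vertex) : QuasiLocal :=
  (l.map fun v => site v M).prod

/-- The string operator of type `k` on a sequence of vertices. When no vertex is repeated this is
the tensor product of Pauli matrices over the vertices of the string. -/
def stringOp : Pauli → List Vertex → QuasiLocal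
  | .x, l => siteProd sigmaX l
  | .y, l => siteProd sigmaX l * siteProd sigmaZ l
  | .z, l => siteProd sigmaZ l

/-- A face (brick), given by its lower left corner `(col, row)`; it is two units wide and one high. -/
structure Face where
  col : ℤ
  row : ℤ
  odd : Odd (col + row)

/-- The six vertices of a face. -/
def Face.boundary (f : Face) : List Vertex :=
  [(f.col, f.row), (f.col + 1, f.row), (f.col + 2, f.row),
   (f.col, f.row + 1), (f.col + 1, f.row + 1), (f.col + 2, f.row + 1)]

/-- The stabilizer `K_f`. -/
def Face.K (f : Face) : QuasiLocal := siteProd sigmaX f.boundary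

/-- The stabilizer `J_f`. -/
def Face.J (f : Face) : QuasiLocal := siteProd sigmaZ f.boundary

/-- The three-coloring of the faces (adjacent faces have corners differing by `(±2, 0)` or
`(±1, ±1)`, hence different colors). -/
def Face.color (f : Face) : Color :=
  if f.col % 3 = 0 then .r else if f.col % 3 = 1 then .g else .b

/-- The edges: all horizontal unit segments, and the vertical unit segments whose lower end has
odd coordinate sum. -/
def IsEdge (v w : Vertex) : Prop :=
  (v.2 = w.2 ∧ (w.1 = v.1 + 1 ∨ v.1 = w.1 + 1)) ∨
  (v.1 = w.1 ∧ ((Odd (v.1 + v.2) ∧ w.2 = v.2 + 1) ∨ (Odd (w.1 + w.2) ∧ v.2 = w.2 + 1)))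

/-- The edge from `v` to `w` connects the face `f` to the face `g`: it leaves `f` at `v` and
arrives in `g` at `w`. An edge has color `c` when it connects two faces of color `c`. -/
structure Connects (v w : Vertex) (f g : Face) : Prop where
  edge : IsEdge v w
  mem_left : v ∈ f.boundary
  mem_right : w ∈ g.boundary
  not_mem_left : v ∉ g.boundary
  not_mem_right : w ∉ f.boundary

/-- A half-infinite string `(f₀, v₀, v₁, f₁, v₂, v₃, f₂, …)` of color `c`: the edge from `v₂ᵢ` to
`v₂ᵢ₊₁` connects the `c`-colored faces `fᵢ` and `fᵢ₊₁`, and the string leaves every finite region,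
that is, it passes through each vertex only finitely often. -/
structure HalfInfiniteString (c : Color) where
  face : ℕ → Face
  vtx : ℕ → Vertex
  color_face : ∀ i, (face i).color = c
  connects : ∀ i, Connects (vtx (2 * i)) (vtx (2 * i + 1)) (face i) (face (i + 1))
  finite_visits : ∀ v, {n | vtx n = v}.Finite

variable {c : Color}

/-- The vertices of the finite string formed by the first `n` faces. -/
def HalfInfiniteString.trunc (γ : HalfInfiniteString c) (n : ℕ) : List Vertex :=
  (List.range (2 * (n - 1))).map γ.vtx

/-- Conjugation by the string operator of the truncated string. -/
def HalfInfiniteString.conj (γ : HalfInfiniteString c) (k : Pauli) (n : ℕ) (a : QuasiLocal) :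
    QuasiLocal :=
  star (stringOp k (γ.trunc n)) * a * stringOp k (γ.trunc n)

theorem siteProd_conj {P : Matrix (Fin 2) (Fin 2) ℂ} (hP : star P * P = 1) (l : List Vertex)
    (v : Vertex) (M : Matrix (Fin 2) (Fin 2) ℂ) :
    star (siteProd P l) * site v M * siteProd P l
      = site v (star (P ^ l.count v) * M * P ^ l.count v) := by
  induction l generalizing M with
  | nil => simp [siteProd]
  | cons w l ih =>
    have h : siteProd P (w :: l) = site w P * siteProd P l := by simp [siteProd]
    have h2 : star (siteProd P (w :: l)) * site v M * siteProd P (w :: l)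
        = star (siteProd P l) * (star (site w P) * site v M * site w P) * siteProd P l := by
      rw [h, star_mul]; simp only [mul_assoc]
    rw [h2, ← map_star]
    by_cases hvw : v = w
    · subst hvw
      rw [← map_mul, ← map_mul, ih, List.count_cons_self, pow_succ']
      simp only [star_mul, mul_assoc]
    · rw [mul_assoc (site w (star P)), site_comm hvw, ← mul_assoc (site w (star P)), ← map_mul, hP, map_one, one_mul, ih,
        List.count_cons_of_ne (Ne.symm hvw)]

theorem siteProd_unitary {P : Matrix (Fin 2) (Fin 2) ℂ} (hP : star P * P = 1) (l : List Vertex) :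
    siteProd P l ∈ unitary QuasiLocal := by
  have hP' : P ∈ unitary (Matrix (Fin 2) (Fin 2) ℂ) := ⟨hP, mul_eq_one_comm.1 hP⟩
  refine Submonoid.list_prod_mem _ fun a ha => ?_
  obtain ⟨v, -, rfl⟩ := List.mem_map.1 ha
  exact Unitary.map_mem (site v) hP'

theorem sigmaX_sq : star sigmaX * sigmaX = 1 := by
  ext i j; fin_cases i <;> fin_cases j <;> simp [sigmaX, Matrix.star_apply, Matrix.mul_apply]

theorem sigmaZ_sq : star sigmaZ * sigmaZ = 1 := by
  ext i j; fin_cases i <;> fin_cases j <;> simp [sigmaZ, Matrix.star_apply, Matrix.mul_apply]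

theorem stringOp_unitary (k : Pauli) (l : List Vertex) : stringOp k l ∈ unitary QuasiLocal := by
  cases k
  · exact siteProd_unitary sigmaX_sq l
  · exact mul_mem (siteProd_unitary sigmaX_sq l) (siteProd_unitary sigmaZ_sq l)
  · exact siteProd_unitary sigmaZ_sq l

theorem stringOp_conj_congr (k : Pauli) {l l' : List Vertex} {v : Vertex}
    (h : l.count v = l'.count v) (M : Matrix (Fin 2) (Fin 2) ℂ) :
    star (stringOp k l) * site v M * stringOp k l
      = star (stringOp k l') * site v M * stringOp k l' := by
  cases k
  · simp only [stringOp, siteProd_conj sigmaX_sq, h]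
  · have e : ∀ l, star (stringOp .y l) * site v M * stringOp .y l
        = star (siteProd sigmaZ l) * (star (siteProd sigmaX l) * site v M * siteProd sigmaX l)
          * siteProd sigmaZ l := fun l => by
      simp only [stringOp, star_mul, mul_assoc]
    simp only [e, siteProd_conj sigmaX_sq, siteProd_conj sigmaZ_sq, h]
  · simp only [stringOp, siteProd_conj sigmaZ_sq, h]

namespace HalfInfiniteString

variable (γ : HalfInfiniteString c) (k : Pauli)

theorem conj_add (n : ℕ) (a b : QuasiLocal) : γ.conj k n (a + b) = γ.conj k n a + γ.conj k n b := by
  simp [conj, mul_add, add_mul]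

theorem conj_sub (n : ℕ) (a b : QuasiLocal) : γ.conj k n (a - b) = γ.conj k n a - γ.conj k n b := by
  simp [conj, mul_sub, sub_mul]

theorem conj_mul (n : ℕ) (a b : QuasiLocal) : γ.conj k n (a * b) = γ.conj k n a * γ.conj k n b := by
  have h := (stringOp_unitary k (γ.trunc n)).2
  simp only [conj, mul_assoc]
  rw [← mul_assoc (stringOp k (γ.trunc n)) (star _), h, one_mul]

theorem conj_star (n : ℕ) (a : QuasiLocal) : γ.conj k n (star a) = star (γ.conj k n a) := by
  simp [conj, mul_assoc]

theorem conj_algebraMap (n : ℕ) (r : ℂ) :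
    γ.conj k n (algebraMap ℂ QuasiLocal r) = algebraMap ℂ QuasiLocal r := by
  rw [conj, ← Algebra.commutes, mul_assoc, (stringOp_unitary k (γ.trunc n)).1, mul_one]

theorem norm_conj (n : ℕ) (a : QuasiLocal) : ‖γ.conj k n a‖ = ‖a‖ := by
  have h := stringOp_unitary k (γ.trunc n)
  rw [conj, CStarRing.norm_mul_mem_unitary _ h,
    CStarRing.norm_mem_unitary_mul _ (Unitary.star_mem h)]

theorem eventually_count (v : Vertex) :
    ∃ N, ∀ n ≥ N, (γ.trunc n).count v = (γ.trunc N).count v := by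
  obtain ⟨B, hB⟩ := (γ.finite_visits v).bddAbove
  refine ⟨B + 2, fun n hn => ?_⟩
  obtain ⟨m, rfl⟩ := Nat.exists_eq_add_of_le hn
  have e : 2 * (B + 2 + m - 1) = 2 * (B + 2 - 1) + 2 * m := by omega
  rw [trunc, trunc, e, List.range_add, List.map_append, List.count_append, Nat.add_eq_left,
    List.count_eq_zero]
  intro hv
  simp only [List.map_map, List.mem_map, List.mem_range, Function.comp_apply] at hv
  obtain ⟨j, -, hj⟩ := hv
  have := hB (show 2 * (B + 2 - 1) + j ∈ {n | γ.vtx n = v} from hj)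
  omega

theorem conj_eventually_const {a : QuasiLocal} (ha : a ∈ strictlyLocalAlgebra Set.univ) :
    ∃ N, ∀ n ≥ N, γ.conj k n a = γ.conj k N a := by
  induction ha using StarAlgebra.adjoin_induction with
  | mem a ha =>
    obtain ⟨v, -, M, rfl⟩ := ha
    obtain ⟨N, hN⟩ := γ.eventually_count v
    exact ⟨N, fun n hn => stringOp_conj_congr k (hN n hn) M⟩
  | algebraMap r => exact ⟨0, fun n _ => by simp only [conj_algebraMap]⟩
  | add a b _ _ iha ihb =>
    obtain ⟨N, hN⟩ := iha
    obtain ⟨N', hN'⟩ := ihb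
    refine ⟨max N N', fun n hn => ?_⟩
    rw [conj_add, conj_add, hN n (le_of_max_le_left hn), hN' n (le_of_max_le_right hn),
      hN _ (le_max_left _ _), hN' _ (le_max_right _ _)]
  | mul a b _ _ iha ihb =>
    obtain ⟨N, hN⟩ := iha
    obtain ⟨N', hN'⟩ := ihb
    refine ⟨max N N', fun n hn => ?_⟩
    rw [conj_mul, conj_mul, hN n (le_of_max_le_left hn), hN' n (le_of_max_le_right hn),
      hN _ (le_max_left _ _), hN' _ (le_max_right _ _)]
  | star a _ ih =>
    obtain ⟨N, hN⟩ := ih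
    exact ⟨N, fun n hn => by rw [conj_star, conj_star, hN n hn]⟩

theorem exists_tendsto_conj (a : QuasiLocal) :
    ∃ b, Tendsto (fun n => γ.conj k n a) atTop (𝓝 b) := by
  refine cauchySeq_tendsto_of_complete (Metric.cauchySeq_iff'.2 fun ε hε => ?_)
  have ha : a ∈ closure (strictlyLocalAlgebra Set.univ : Set QuasiLocal) := by
    have : a ∈ localAlgebra Set.univ := by rw [localAlgebra_univ]; trivial
    exact this
  obtain ⟨b, hb, hab⟩ := Metric.mem_closure_iff.1 ha (ε / 2) (by positivity)
  obtain ⟨N, hN⟩ := γ.conj_eventually_const k hb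
  refine ⟨N, fun n hn => ?_⟩
  have h : ∀ n, dist (γ.conj k n a) (γ.conj k n b) < ε / 2 := fun n => by
    rw [dist_eq_norm, ← conj_sub, norm_conj, ← dist_eq_norm]; exact hab
  calc _ ≤ dist (γ.conj k n a) (γ.conj k n b) + dist (γ.conj k n b) (γ.conj k N a) :=
        dist_triangle _ _ _
    _ < ε / 2 + ε / 2 := by
        refine add_lt_add (h n) ?_
        rw [hN n hn, dist_comm]
        exact h N
    _ = ε := add_halves ε

/-- The norm limit of the conjugations by the truncated string operators. -/
def endoFun (a : QuasiLocal) : QuasiLocal := (γ.exists_tendsto_conj k a).choose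

theorem tendsto_conj (a : QuasiLocal) :
    Tendsto (fun n => γ.conj k n a) atTop (𝓝 (γ.endoFun k a)) :=
  (γ.exists_tendsto_conj k a).choose_spec

theorem endoFun_eq {a b : QuasiLocal} (h : Tendsto (fun n => γ.conj k n a) atTop (𝓝 b)) :
    γ.endoFun k a = b :=
  tendsto_nhds_unique (γ.tendsto_conj k a) h

theorem endoFun_algebraMap (r : ℂ) :
    γ.endoFun k (algebraMap ℂ QuasiLocal r) = algebraMap ℂ QuasiLocal r :=
  γ.endoFun_eq k (by simp only [conj_algebraMap]; exact tendsto_const_nhds)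

/-- The endomorphism `ρ_γ^{ck}`. -/
def endo : QuasiLocal →⋆ₐ[ℂ] QuasiLocal where
  toFun := γ.endoFun k
  map_one' := by simpa using γ.endoFun_algebraMap k 1
  map_mul' a b := γ.endoFun_eq k (by
    simp only [conj_mul]; exact (γ.tendsto_conj k a).mul (γ.tendsto_conj k b))
  map_zero' := by simpa using γ.endoFun_algebraMap k 0
  map_add' a b := γ.endoFun_eq k (by
    simp only [conj_add]; exact (γ.tendsto_conj k a).add (γ.tendsto_conj k b))
  commutes' := γ.endoFun_algebraMap k
  map_star' a := γ.endoFun_eq k (by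
    simp only [conj_star]; exact (γ.tendsto_conj k a).star)

end HalfInfiniteString

/-- Positive linear functionals on the quasi-local algebra. -/
abbrev Functional : Type := QuasiLocal →ₚ[ℂ] ℂ

/-- The functional is a state taking the value `1` on all the stabilizers. This determines the
ground state of the model. -/
def IsVacuum (ω : Functional) : Prop :=
  ω 1 = 1 ∧ ∀ f : Face, ω f.K = 1 ∧ ω f.J = 1

/-- The state `ω ∘ ρ_γ^{ck}`. -/
def stringState (ω : Functional) (γ : HalfInfiniteString c) (k : Pauli) :
    Functional :=
  ω.comp (PositiveLinearMap.ofClass (γ.endo k))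

/-- Representations of the quasi-local algebra on a Hilbert space. -/
abbrev Rep (H : Type*) [NormedAddCommGroup H] [InnerProductSpace ℂ H] [CompleteSpace H] :=
  QuasiLocal →⋆ₐ[ℂ] (H →L[ℂ] H)

/-- The GNS representation of a positive functional. -/
abbrev gns (ω : Functional) : Rep ω.GNS := ω.gnsStarAlgHom

/-- Unitary equivalence of the restrictions of two representations to a subalgebra. -/
def EquivalentOn {H₁ H₂ : Type*} [NormedAddCommGroup H₁] [InnerProductSpace ℂ H₁]
    [CompleteSpace H₁] [NormedAddCommGroup H₂] [InnerProductSpace ℂ H₂] [CompleteSpace H₂]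
    (B : StarSubalgebra ℂ QuasiLocal) (π₁ : Rep H₁) (π₂ : Rep H₂) : Prop :=
  ∃ U : H₁ ≃ₗᵢ[ℂ] H₂, ∀ a ∈ B, ∀ x, U (π₁ a x) = π₂ a (U x)

/-- Unitary equivalence of two representations. -/
def Equivalent {H₁ H₂ : Type*} [NormedAddCommGroup H₁] [InnerProductSpace ℂ H₁]
    [CompleteSpace H₁] [NormedAddCommGroup H₂] [InnerProductSpace ℂ H₂] [CompleteSpace H₂]
    (π₁ : Rep H₁) (π₂ : Rep H₂) : Prop :=
  ∃ U : H₁ ≃ₗᵢ[ℂ] H₂, ∀ a x, U (π₁ a x) = π₂ a (U x)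

/-- The position of a vertex in the plane. -/
def position (v : Vertex) : EuclideanSpace ℝ (Fin 2) := !₂[(v.1 : ℝ), (v.2 : ℝ)]

/-- A cone of vertices: the vertices in an open cone with apex `p`, axis `a` and half-opening
angle `θ`. -/
def IsCone (Λ : Set Vertex) : Prop :=
  ∃ (p a : EuclideanSpace ℝ (Fin 2)) (θ : ℝ), ‖a‖ = 1 ∧ 0 < θ ∧ θ < Real.pi ∧
    Λ = {v | ‖position v - p‖ * Real.cos θ < ⟪position v - p, a⟫_ℝ}

/-- The superselection criterion relative to the GNS representation of `ω₀`: outside any cone the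
representation is unitarily equivalent to that of `ω₀`. -/
def SatisfiesSuperselection (ω₀ : Functional) {H : Type*} [NormedAddCommGroup H]
    [InnerProductSpace ℂ H] [CompleteSpace H] (π : Rep H) : Prop :=
  ∀ Λ : Set Vertex, IsCone Λ → EquivalentOn (localAlgebra Λᶜ) π (gns ω₀)

end
end ColorCode

/-!
Write `XᵃZᵇ` for the product of `σˣ` over the vertices of a finite chain `a` and of `σᶻ` over those
of `b`, chains being taken modulo two. The span of these Pauli operators is dense, and conjugation
by a string, finite or not, multiplies each of them by a sign, the symplectic pairing of the chains.

A finite chain meets every face evenly if and only if it is a sum of boundaries of faces. A Pauli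
operator that is not a product of stabilizers therefore anticommutes with some stabilizer, so a
ground state is `0` on it; on products of stabilizers a ground state is `1`. This gives uniqueness,
and shows that the state of a string only depends on the stabilizers the string violates, that is,
on its type and starting face. For existence, take a limit of the uniform superpositions of the
finite groups generated by the boundaries of finitely many faces.

Any two faces of the same color are joined by a finite string, and conjugation by it moves the
charge from one face to the other. In particular the charge can be moved onto a string that runs off
to infinity inside a given cone, and conjugation by that string fixes the observables outside the
cone. Conversely, the sum of all faces of two colors in a large region is a loop around the region:
loops of type `σˣ` and `σᶻ` commute with all observables inside, and their signs reveal the type.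
-/

namespace ColorCode
open scoped ComplexOrder InnerProductSpace CStarAlgebra Fin.CommRing
open Filter Topology
noncomputable section

section CStarAlgebra

variable {A B : Type*} [CStarAlgebra A] [CStarAlgebra B]
  {H H₁ H₂ : Type*} [NormedAddCommGroup H] [InnerProductSpace ℂ H] [CompleteSpace H]
  [NormedAddCommGroup H₁] [InnerProductSpace ℂ H₁] [CompleteSpace H₁]
  [NormedAddCommGroup H₂] [InnerProductSpace ℂ H₂] [CompleteSpace H₂]

theorem inner_map_apply_map_apply (π : A →⋆ₐ[ℂ] (H →L[ℂ] H)) (a b : A) (ξ η : H) :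
    ⟪π a ξ, π b η⟫_ℂ = ⟪ξ, π (star a * b) η⟫_ℂ := by
  rw [map_mul, map_star, mul_apply_eq_comp, ContinuousLinearMap.star_eq_adjoint,
    ContinuousLinearMap.adjoint_inner_right]

theorem norm_map_apply_of_mem_unitary (π : A →⋆ₐ[ℂ] (H →L[ℂ] H)) {u : A} (hu : u ∈ unitary A)
    (ξ : H) : ‖π u ξ‖ = ‖ξ‖ := by
  rw [@norm_eq_sqrt_re_inner ℂ, inner_map_apply_map_apply, hu.1, map_one, one_apply_eq_self,
    ← @norm_eq_sqrt_re_inner ℂ]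

theorem map_apply_eq_smul_of_inner_eq {π : A →⋆ₐ[ℂ] (H →L[ℂ] H)} {u : A} (hu : u ∈ unitary A)
    {ξ : H} (hξ : ‖ξ‖ = 1) {z : ℂ} (hz : ‖z‖ = 1) (h : ⟪ξ, π u ξ⟫_ℂ = z) : π u ξ = z • ξ := by
  refine ((inner_eq_one_iff_of_norm_eq_one (𝕜 := ℂ) (by rw [norm_smul, hz, hξ, one_mul])
    (by rw [norm_map_apply_of_mem_unitary π hu, hξ])).1 ?_).symm
  rw [inner_smul_left, h, Complex.conj_mul', hz]
  norm_num

theorem inner_eq_zero_of_map_apply_eq_smul {π : A →⋆ₐ[ℂ] (H →L[ℂ] H)} {u : A}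
    (hu : u ∈ unitary A) {ξ η : H} {z w : ℂ} (hz : ‖z‖ = 1) (hzw : z ≠ w)
    (hξ : π u ξ = z • ξ) (hη : π u η = w • η) : ⟪ξ, η⟫_ℂ = 0 := by
  have h := inner_map_apply_map_apply π u u ξ η
  rw [hu.1, map_one, one_apply_eq_self, hξ, hη, inner_smul_left, inner_smul_right,
    ← mul_assoc] at h
  by_contra h0
  have hzw' : starRingEnd ℂ z * w = 1 := by
    simpa using mul_right_cancel₀ h0 (h.trans (one_mul _).symm)
  refine hzw ?_
  calc z = z * (starRingEnd ℂ z * w) := by rw [hzw', mul_one]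
    _ = w := by rw [← mul_assoc, Complex.mul_conj', hz]; norm_num

theorem exists_linearIsometryEquiv_of_inner_eq {π₁ : A →⋆ₐ[ℂ] (H₁ →L[ℂ] H₁)}
    {π₂ : A →⋆ₐ[ℂ] (H₂ →L[ℂ] H₂)} {ξ₁ : H₁} {ξ₂ : H₂} (h₁ : DenseRange fun a => π₁ a ξ₁)
    (h₂ : DenseRange fun a => π₂ a ξ₂) (h : ∀ a, ⟪ξ₁, π₁ a ξ₁⟫_ℂ = ⟪ξ₂, π₂ a ξ₂⟫_ℂ) :
    ∃ U : H₁ ≃ₗᵢ[ℂ] H₂, ∀ a x, U (π₁ a x) = π₂ a (U x) := by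
  let orbit₁ : A →ₗ[ℂ] H₁ := LinearMap.applyₗ ξ₁ ∘ₗ ContinuousLinearMap.coeLM ℂ ∘ₗ π₁.toLinearMap
  let orbit₂ : A →ₗ[ℂ] H₂ := LinearMap.applyₗ ξ₂ ∘ₗ ContinuousLinearMap.coeLM ℂ ∘ₗ π₂.toLinearMap
  have norm_eq : ∀ a, ‖orbit₂ a‖ = ‖orbit₁ a‖ := fun a => by
    change ‖π₂ a ξ₂‖ = ‖π₁ a ξ₁‖
    rw [@norm_eq_sqrt_re_inner ℂ, @norm_eq_sqrt_re_inner ℂ, inner_map_apply_map_apply,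
      inner_map_apply_map_apply, h]
  let U := (LinearEquiv.refl ℂ A).extendOfIsometry orbit₁ orbit₂ h₁ h₂ norm_eq
  have hU : ∀ a, U (π₁ a ξ₁) = π₂ a ξ₂ :=
    (LinearEquiv.refl ℂ A).extendOfIsometry_eq orbit₁ orbit₂ h₁ h₂ norm_eq
  refine ⟨U, fun a x => h₁.induction_on (p := fun x => U (π₁ a x) = π₂ a (U x)) x
    (isClosed_eq (by fun_prop) (by fun_prop)) fun b => ?_⟩
  rw [hU, ← mul_apply_eq_comp, ← map_mul, hU, map_mul, mul_apply_eq_comp]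

theorem exists_tendsto_of_equicontinuous_of_dense {ι X Y : Type*} [TopologicalSpace X]
    [UniformSpace Y] [CompleteSpace Y] {l : Filter ι} [l.NeBot] {F : ι → X → Y}
    (hF : Equicontinuous F) {s : Set X} (hs : Dense s)
    (h : ∀ x ∈ s, ∃ y, Tendsto (F · x) l (𝓝 y)) (x : X) : ∃ y, Tendsto (F · x) l (𝓝 y) := by
  refine cauchy_map_iff_exists_tendsto.1 (cauchy_map_iff'.2 fun U hU => ?_)
  obtain ⟨V, hV, hVsymm, hVU⟩ := comp_comp_symm_mem_uniformity_sets hU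
  obtain ⟨x', hx', hclose⟩ := hs.inter_nhds_nonempty (hF x V hV)
  obtain ⟨y, hy⟩ := h x' hx'
  refine mem_map.2 (mem_of_superset (mem_map.1 (cauchy_map_iff'.1 hy.cauchy_map hV)) ?_)
  rintro ⟨i, j⟩ hij
  exact hVU ⟨_, ⟨_, hclose i, hij⟩, hVsymm.symm _ _ (hclose j)⟩

theorem exists_starAlgHom_tendsto {ι : Type*} {l : Filter ι} [l.NeBot] (α : ι → A →⋆ₐ[ℂ] B)
    {s : Set A} (hs : Dense s) (h : ∀ a ∈ s, ∃ b, Tendsto (α · a) l (𝓝 b)) :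
    ∃ ρ : A →⋆ₐ[ℂ] B, ∀ a, Tendsto (α · a) l (𝓝 (ρ a)) := by
  have lipschitz : ∀ i, LipschitzWith 1 (α i) := fun i =>
    AddMonoidHomClass.lipschitz_of_bound (α i) 1 (fun a => by
      simpa using NonUnitalStarAlgHom.norm_apply_le (α i) a) |>.weaken (by simp)
  choose ρ hρ using exists_tendsto_of_equicontinuous_of_dense
    (LipschitzWith.uniformEquicontinuous _ 1 lipschitz).equicontinuous hs h
  have limit_eq : ∀ {a b}, Tendsto (α · a) l (𝓝 b) → ρ a = b := tendsto_nhds_unique (hρ _)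
  have algebraMap_eq : ∀ r, ρ (algebraMap ℂ A r) = algebraMap ℂ B r := fun r =>
    limit_eq (by simp only [AlgHomClass.commutes, tendsto_const_nhds])
  exact ⟨{
    toFun := ρ
    map_one' := by simpa using algebraMap_eq 1
    map_mul' a b := limit_eq (by simpa only [map_mul] using (hρ a).mul (hρ b))
    map_zero' := by simpa using algebraMap_eq 0
    map_add' a b := limit_eq (by simpa only [map_add] using (hρ a).add (hρ b))
    commutes' := algebraMap_eq
    map_star' a := limit_eq (by simpa only [map_star] using (hρ a).star) }, hρ⟩

variable [PartialOrder A] [StarOrderedRing A]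

/-- The positive functional `a ↦ ⟪ξ, π a ξ⟫` of a vector in a representation. -/
def vectorFunctional (π : A →⋆ₐ[ℂ] (H →L[ℂ] H)) (ξ : H) : A →ₚ[ℂ] ℂ :=
  .mk₀ (innerₛₗ ℂ ξ ∘ₗ LinearMap.applyₗ ξ ∘ₗ ContinuousLinearMap.coeLM ℂ ∘ₗ π.toLinearMap)
    fun a ha => by
      obtain ⟨b, rfl⟩ := CStarAlgebra.nonneg_iff_eq_star_mul_self.1 ha
      change 0 ≤ ⟪ξ, π (star b * b) ξ⟫_ℂ
      rw [← inner_map_apply_map_apply]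
      exact (inner_self_eq_norm_sq_to_K (𝕜 := ℂ) (π b ξ)).symm ▸ by positivity

theorem vectorFunctional_apply (π : A →⋆ₐ[ℂ] (H →L[ℂ] H)) (ξ : H) (a : A) :
    vectorFunctional π ξ a = ⟪ξ, π a ξ⟫_ℂ := rfl

theorem norm_vectorFunctional_apply_le (π : A →⋆ₐ[ℂ] (H →L[ℂ] H)) {ξ : H} (hξ : ‖ξ‖ = 1) (a : A) :
    ‖vectorFunctional π ξ a‖ ≤ ‖a‖ :=
  calc ‖⟪ξ, π a ξ⟫_ℂ‖ ≤ ‖ξ‖ * ‖π a ξ‖ := norm_inner_le_norm _ _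
    _ ≤ ‖π a‖ := by simpa [hξ] using (π a).le_opNorm ξ
    _ ≤ ‖a‖ := NonUnitalStarAlgHom.norm_apply_le π a

theorem exists_positiveLinearMap_tendsto {ι : Type*} (𝒰 : Ultrafilter ι) (ω : ι → A →ₚ[ℂ] ℂ)
    (hω : ∀ a, ∃ C, ∀ i, ‖ω i a‖ ≤ C) : ∃ φ : A →ₚ[ℂ] ℂ, ∀ a, Tendsto (ω · a) 𝒰 (𝓝 (φ a)) := by
  have limit_exists : ∀ a, ∃ z, Tendsto (ω · a) 𝒰 (𝓝 z) := fun a => by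
    obtain ⟨C, hC⟩ := hω a
    obtain ⟨z, -, hz⟩ := (isCompact_closedBall (0 : ℂ) C).ultrafilter_le_nhds (𝒰.map (ω · a))
      (le_principal_iff.2 (mem_map.2 (univ_mem' fun i => mem_closedBall_zero_iff.2 (hC i))))
    exact ⟨z, hz⟩
  choose φ hφ using limit_exists
  exact ⟨.mk₀ {
    toFun := φ
    map_add' a b := tendsto_nhds_unique (hφ _) (by simpa only [map_add] using (hφ a).add (hφ b))
    map_smul' r a := tendsto_nhds_unique (hφ _) (by
      simpa only [map_smul, RingHom.id_apply] using (hφ a).const_smul r) }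
    fun a ha => ge_of_tendsto' (hφ a) fun i => map_nonneg (ω i) ha, hφ⟩

variable {ω ω₁ ω₂ : A →ₚ[ℂ] ℂ}

/-- The cyclic vector of the GNS representation: the class of the unit of the algebra. -/
def gnsVector (ω : A →ₚ[ℂ] ℂ) : ω.GNS := (ω.toPreGNS 1 : ω.PreGNS)

theorem gnsStarAlgHom_apply_gnsVector (ω : A →ₚ[ℂ] ℂ) (a : A) :
    ω.gnsStarAlgHom a (gnsVector ω) = (ω.toPreGNS a : ω.PreGNS) := by
  change ω.gnsNonUnitalStarAlgHom a (gnsVector ω) = _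
  rw [gnsVector, PositiveLinearMap.gnsNonUnitalStarAlgHom_apply_coe]
  exact congrArg (fun b => ((ω.toPreGNS b : ω.PreGNS) : ω.GNS)) (mul_one a)

theorem inner_gnsVector (ω : A →ₚ[ℂ] ℂ) (a : A) :
    ⟪gnsVector ω, ω.gnsStarAlgHom a (gnsVector ω)⟫_ℂ = ω a := by
  rw [gnsStarAlgHom_apply_gnsVector, gnsVector, UniformSpace.Completion.inner_coe,
    PositiveLinearMap.preGNS_inner_def]
  simp

theorem denseRange_gnsVector (ω : A →ₚ[ℂ] ℂ) :
    DenseRange fun a => ω.gnsStarAlgHom a (gnsVector ω) := by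
  simp only [gnsStarAlgHom_apply_gnsVector]
  exact UniformSpace.Completion.denseRange_coe.comp ω.toPreGNS.surjective.denseRange
    (UniformSpace.Completion.continuous_coe _)

theorem norm_gnsVector (hω : ω 1 = 1) : ‖gnsVector ω‖ = 1 := by
  have h := inner_gnsVector ω 1
  rw [map_one, hω, one_apply_eq_self] at h
  rw [@norm_eq_sqrt_re_inner ℂ, h, RCLike.one_re, Real.sqrt_one]

theorem gnsStarAlgHom_apply_gnsVector_eq_smul (hω : ω 1 = 1) {u : A} (hu : u ∈ unitary A) {z : ℂ}
    (hz : ‖z‖ = 1) (h : ω u = z) : ω.gnsStarAlgHom u (gnsVector ω) = z • gnsVector ω :=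
  map_apply_eq_smul_of_inner_eq hu (norm_gnsVector hω) hz ((inner_gnsVector ω u).trans h)

theorem map_mul_of_norm_apply_eq_one (hω : ω 1 = 1) {u : A} (hu : u ∈ unitary A)
    (h : ‖ω u‖ = 1) (a : A) : ω (a * u) = ω a * ω u := by
  rw [← inner_gnsVector, map_mul, mul_apply_eq_comp,
    gnsStarAlgHom_apply_gnsVector_eq_smul hω hu h rfl, map_smul, inner_smul_right, inner_gnsVector,
    mul_comm]

theorem map_star_mul_mul_of_norm_apply_eq_one (hω : ω 1 = 1) {u : A} (hu : u ∈ unitary A)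
    (h : ‖ω u‖ = 1) (a : A) : ω (star u * a * u) = ω a := by
  have inner_eq := inner_map_apply_map_apply ω.gnsStarAlgHom u (a * u) (gnsVector ω) (gnsVector ω)
  rw [map_mul, mul_apply_eq_comp, gnsStarAlgHom_apply_gnsVector_eq_smul hω hu h rfl, map_smul,
    inner_smul_left, inner_smul_right, inner_gnsVector, inner_gnsVector, ← mul_assoc, ← mul_assoc,
    Complex.conj_mul', h] at inner_eq
  simpa using inner_eq.symm

theorem exists_linearIsometryEquiv_gns {π : A →⋆ₐ[ℂ] (H →L[ℂ] H)} {ξ : H}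
    (hξ : DenseRange fun a => π a ξ) (h : ∀ a, ⟪ξ, π a ξ⟫_ℂ = ω a) :
    ∃ U : ω.GNS ≃ₗᵢ[ℂ] H, ∀ a x, U (ω.gnsStarAlgHom a x) = π a (U x) :=
  exists_linearIsometryEquiv_of_inner_eq (denseRange_gnsVector ω) hξ fun a => by
    rw [inner_gnsVector, h]

theorem exists_linearIsometryEquiv_gns_of_conj {u : A} (hu : u ∈ unitary A)
    (h : ∀ a, ω₂ a = ω₁ (star u * a * u)) :
    ∃ U : ω₂.GNS ≃ₗᵢ[ℂ] ω₁.GNS, ∀ a x, U (ω₂.gnsStarAlgHom a x) = ω₁.gnsStarAlgHom a (U x) := by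
  refine exists_linearIsometryEquiv_gns (ξ := ω₁.gnsStarAlgHom u (gnsVector ω₁)) ?_ fun a => ?_
  · have surjective_mul_right : Function.Surjective (· * u) := fun b =>
      ⟨b * star u, by simp only [mul_assoc, hu.1, mul_one]⟩
    have continuous_orbit : Continuous fun a => ω₁.gnsStarAlgHom a (gnsVector ω₁) :=
      (map_continuous ω₁.gnsStarAlgHom).clm_apply continuous_const
    simpa only [Function.comp_def, map_mul, mul_apply_eq_comp] using
      (denseRange_gnsVector ω₁).comp surjective_mul_right.denseRange continuous_orbit
  · rw [← mul_apply_eq_comp, ← map_mul, inner_map_apply_map_apply, inner_gnsVector, h, mul_assoc]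

theorem eq_of_gns_equivalent_of_commute (hω₁ : ω₁ 1 = 1) (hω₂ : ω₂ 1 = 1)
    (hequiv : ∃ U : ω₁.GNS ≃ₗᵢ[ℂ] ω₂.GNS,
      ∀ a x, U (ω₁.gnsStarAlgHom a x) = ω₂.gnsStarAlgHom a (U x))
    {s : Set A} (hs : Dense s) {z₁ z₂ : ℂ} (hz₁ : ‖z₁‖ = 1) (hz₂ : ‖z₂‖ = 1)
    (h : ∀ b ∈ s, ∃ u ∈ unitary A, Commute u b ∧ ω₁ u = z₁ ∧ ω₂ u = z₂) : z₁ = z₂ := by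
  obtain ⟨U, hU⟩ := hequiv
  by_contra hne
  have orthogonal : ∀ b ∈ s, ⟪U (gnsVector ω₁), ω₂.gnsStarAlgHom b (gnsVector ω₂)⟫_ℂ = 0 := by
    intro b hb
    obtain ⟨u, hu, hub, h₁, h₂⟩ := h b hb
    refine inner_eq_zero_of_map_apply_eq_smul hu hz₁ hne (π := ω₂.gnsStarAlgHom) ?_ ?_
    · rw [← hU, gnsStarAlgHom_apply_gnsVector_eq_smul hω₁ hu hz₁ h₁, map_smul]
    · rw [← mul_apply_eq_comp, ← map_mul, hub.eq, map_mul, mul_apply_eq_comp,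
        gnsStarAlgHom_apply_gnsVector_eq_smul hω₂ hu hz₂ h₂, map_smul]
  have continuous_orbit : Continuous fun a => ω₂.gnsStarAlgHom a (gnsVector ω₂) :=
    (map_continuous ω₂.gnsStarAlgHom).clm_apply continuous_const
  have hzero : U (gnsVector ω₁) = 0 := by
    refine ((denseRange_gnsVector ω₂).dense_image continuous_orbit hs).eq_zero_of_inner_left ℂ ?_
    rintro _ ⟨b, hb, rfl⟩
    exact orthogonal b hb
  have hnorm := U.norm_map (gnsVector ω₁)
  rw [hzero, norm_zero, norm_gnsVector hω₁] at hnorm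
  exact zero_ne_one hnorm

end CStarAlgebra

section Chains

variable {ι : Type*}

/-- The additive character `x ↦ (-1) ^ x` of `ℤ/2`. -/
def sign : AddChar (Fin 2) ℂ where
  toFun x := (-1) ^ x.val
  map_zero_eq_one' := rfl
  map_add_eq_mul' x y := by fin_cases x <;> fin_cases y <;> norm_num

theorem sign_one : sign 1 = -1 := pow_one _

theorem sign_mul_self (x : Fin 2) : sign x * sign x = 1 := by
  rw [← AddChar.map_add_eq_mul, CharTwo.add_self_eq_zero, AddChar.map_zero_eq_one]

theorem norm_sign (x : Fin 2) : ‖sign x‖ = 1 :=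
  AddChar.norm_apply sign x

theorem sign_injective : Function.Injective sign := by
  intro x y h
  fin_cases x <;> fin_cases y <;> simp_all [sign_one] <;> norm_num at h

/-- The pairing `∑ v, S v * a v` of an arbitrary chain `S` with a finite chain `a`. -/
def pairing : (ι → Fin 2) →ₗ[Fin 2] (ι →₀ Fin 2) →ₗ[Fin 2] Fin 2 :=
  Finsupp.bilinearCombination (Fin 2) (Fin 2)

theorem pairing_apply (S : ι → Fin 2) (a : ι →₀ Fin 2) :
    pairing S a = a.sum fun v x => x * S v := rfl

theorem pairing_single (S : ι → Fin 2) (v : ι) (x : Fin 2) :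
    pairing S (Finsupp.single v x) = x * S v := by
  simp [pairing_apply]

theorem pairing_congr {S S' : ι → Fin 2} {a : ι →₀ Fin 2} (h : ∀ v ∈ a.support, S v = S' v) :
    pairing S a = pairing S' a :=
  Finsupp.sum_congr fun v hv => congrArg (a v * ·) (h v hv)

theorem pairing_comm (a b : ι →₀ Fin 2) : pairing a b = pairing b a := by
  induction b using Finsupp.induction_linear with
  | zero => simp
  | add b b' ih ih' => simp only [Finsupp.coe_add, map_add, LinearMap.add_apply, ih, ih']
  | single v x =>
    rw [pairing_single, pairing_apply, Finsupp.sum_eq_single v (by simp_all) (by simp),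
      Finsupp.single_eq_same, mul_comm]

theorem chain_add_self (a : ι →₀ Fin 2) : a + a = 0 := by
  ext1 v
  exact CharTwo.add_self_eq_zero (a v)

/-- The chain of a list of points, counting them modulo two. -/
def chain (l : List ι) : ι →₀ Fin 2 :=
  (l.map fun v => Finsupp.single v 1).sum

theorem chain_cons (v : ι) (l : List ι) : chain (v :: l) = Finsupp.single v 1 + chain l := by
  rw [chain, List.map_cons, List.sum_cons, ← chain]

theorem chain_apply [BEq ι] [LawfulBEq ι] (l : List ι) (v : ι) :
    chain l v = (l.count v : Fin 2) := by
  induction l with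
  | nil => simp [chain]
  | cons w l ih =>
    rw [chain_cons, Finsupp.add_apply, ih, List.count_cons, add_comm]
    by_cases h : w = v <;> simp [h]

theorem pairing_chain (S : ι → Fin 2) (l : List ι) : pairing S (chain l) = (l.map S).sum := by
  induction l with
  | nil => simp [chain]
  | cons v l ih =>
    rw [chain_cons, map_add, pairing_single, one_mul, ih, List.map_cons, List.sum_cons]

theorem chain_toList_support (a : ι →₀ Fin 2) : chain a.support.toList = a := by
  rw [chain, Finset.sum_map_toList]
  refine (Finset.sum_congr rfl fun v hv => ?_).trans a.sum_single
  rw [Fin.eq_one_of_ne_zero _ (Finsupp.mem_support_iff.1 hv)]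

/-- The symplectic form on pairs of chains, which governs the commutation of Pauli operators. -/
def symplectic (S T : ι → Fin 2) (a b : ι →₀ Fin 2) : Fin 2 :=
  pairing S b + pairing T a

end Chains

section Weyl

theorem quasiLocal_ext {A B : QuasiLocal} (h : ∀ ψ s, toOp A ψ s = toOp B ψ s) : A = B :=
  toOp_injective (by ext ψ s; exact h ψ s)

theorem siteOp_sigmaX_apply (v : Vertex) (ψ : RefSpace) (s : Config) :
    siteOp v sigmaX ψ s = ψ (s + Finsupp.single v 1) := by
  have update_eq : s.update v (s v + 1) = s + Finsupp.single v 1 := by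
    ext1 w
    by_cases hw : w = v <;> simp [Finsupp.update_apply, hw]
  rw [siteOp_apply, ← update_eq, Fin.sum_univ_two]
  generalize s v = x
  fin_cases x <;> simp [sigmaX]

theorem siteOp_sigmaZ_apply (v : Vertex) (ψ : RefSpace) (s : Config) :
    siteOp v sigmaZ ψ s = sign (s v) * ψ s := by
  have update_eq : s.update v (s v) = s := by
    ext1 w
    by_cases hw : w = v <;> simp [hw]
  rw [siteOp_apply, Fin.sum_univ_two]
  revert update_eq
  generalize s v = x
  fin_cases x <;> simp +contextual [sigmaZ, sign_one]

theorem toOp_siteProd_sigmaX_apply (l : List Vertex) (ψ : RefSpace) (s : Config) :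
    toOp (siteProd sigmaX l) ψ s = ψ (s + chain l) := by
  induction l generalizing s with
  | nil => simp [siteProd, chain]
  | cons v l ih =>
    rw [siteProd, List.map_cons, List.prod_cons, ← siteProd, map_mul, toOp_site,
      mul_apply_eq_comp, siteOp_sigmaX_apply, ih, chain_cons, add_assoc]

theorem toOp_siteProd_sigmaZ_apply (l : List Vertex) (ψ : RefSpace) (s : Config) :
    toOp (siteProd sigmaZ l) ψ s = sign (pairing s (chain l)) * ψ s := by
  induction l generalizing s with
  | nil => simp [siteProd, chain]
  | cons v l ih =>
    rw [siteProd, List.map_cons, List.prod_cons, ← siteProd, map_mul, toOp_site,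
      mul_apply_eq_comp, siteOp_sigmaZ_apply, ih, chain_cons, map_add, AddChar.map_add_eq_mul,
      pairing_single, one_mul, mul_assoc]

/-- The Weyl operator `XᵃZᵇ`: the product of `σˣ` over the chain `a` times the product of `σᶻ`
over the chain `b`. -/
def weyl (a b : Config) : QuasiLocal :=
  siteProd sigmaX a.support.toList * siteProd sigmaZ b.support.toList

theorem toOp_weyl_apply (a b : Config) (ψ : RefSpace) (s : Config) :
    toOp (weyl a b) ψ s = sign (pairing ⇑(s + a) b) * ψ (s + a) := by
  rw [weyl, map_mul, mul_apply_eq_comp, toOp_siteProd_sigmaX_apply, toOp_siteProd_sigmaZ_apply,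
    chain_toList_support, chain_toList_support]

theorem weyl_zero : weyl 0 0 = 1 := by
  simp [weyl, siteProd]

theorem siteProd_sigmaX_mul_siteProd_sigmaZ (l l' : List Vertex) :
    siteProd sigmaX l * siteProd sigmaZ l' = weyl (chain l) (chain l') :=
  quasiLocal_ext fun ψ s => by
    rw [toOp_weyl_apply, map_mul, mul_apply_eq_comp, toOp_siteProd_sigmaX_apply,
      toOp_siteProd_sigmaZ_apply]

theorem siteProd_sigmaX (l : List Vertex) : siteProd sigmaX l = weyl (chain l) 0 := by
  simpa [siteProd, chain] using siteProd_sigmaX_mul_siteProd_sigmaZ l []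

theorem siteProd_sigmaZ (l : List Vertex) : siteProd sigmaZ l = weyl 0 (chain l) := by
  simpa [siteProd, chain] using siteProd_sigmaX_mul_siteProd_sigmaZ [] l

theorem weyl_mem_unitary (a b : Config) : weyl a b ∈ unitary QuasiLocal :=
  mul_mem (siteProd_unitary sigmaX_sq _) (siteProd_unitary sigmaZ_sq _)

theorem weyl_mul_weyl (a b c d : Config) :
    weyl a b * weyl c d = sign (pairing b c) • weyl (a + c) (b + d) :=
  quasiLocal_ext fun ψ s => by
    rw [map_mul, mul_apply_eq_comp, map_smul, toOp_weyl_apply, toOp_weyl_apply,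
      smul_apply, lp.coeFn_smul, Pi.smul_apply, smul_eq_mul, toOp_weyl_apply, ← add_assoc,
      pairing_comm b c]
    simp only [Finsupp.coe_add, map_add, LinearMap.add_apply, AddChar.map_add_eq_mul]
    linear_combination (-sign (pairing s b) * sign (pairing a b) *
      (sign (pairing s d) * sign (pairing a d) * sign (pairing c d)) * ψ (s + a + c)) *
      sign_mul_self (pairing c b)

theorem weyl_mul_comm (a b c d : Config) :
    weyl a b * weyl c d = sign (symplectic c d a b) • (weyl c d * weyl a b) := by
  rw [weyl_mul_weyl, weyl_mul_weyl, smul_smul, symplectic, AddChar.map_add_eq_mul, mul_assoc,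
    sign_mul_self, mul_one, pairing_comm b c, add_comm a, add_comm b]

theorem star_weyl (a b : Config) : star (weyl a b) = sign (pairing b a) • weyl a b := by
  refine left_inv_eq_right_inv (weyl_mem_unitary a b).1 ?_
  rw [mul_smul_comm, weyl_mul_weyl, smul_smul, sign_mul_self, one_smul, chain_add_self,
    chain_add_self, weyl_zero]

theorem star_weyl_mul_weyl_mul_weyl (a b c d : Config) :
    star (weyl c d) * weyl a b * weyl c d = sign (symplectic c d a b) • weyl a b := by
  rw [mul_assoc, weyl_mul_comm, mul_smul_comm, ← mul_assoc, (weyl_mem_unitary c d).1, one_mul]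

end Weyl

section WeylSpan

theorem site_mem_span_weyl (v : Vertex) (M : Matrix (Fin 2) (Fin 2) ℂ) :
    site v M ∈ Submodule.span ℂ (Set.range fun x : Fin 2 × Fin 2 =>
      weyl (Finsupp.single v x.1) (Finsupp.single v x.2)) := by
  have pauli_expansion : M = ((M 0 0 + M 1 1) / 2) • 1 + ((M 0 1 + M 1 0) / 2) • sigmaX
      + ((M 0 0 - M 1 1) / 2) • sigmaZ + ((M 1 0 - M 0 1) / 2) • (sigmaX * sigmaZ) := by
    ext i j
    fin_cases i <;> fin_cases j <;> simp [sigmaX, sigmaZ] <;> ring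
  have one_eq : site v 1 = weyl (Finsupp.single v 0) (Finsupp.single v 0) := by
    simp [weyl_zero]
  have sigmaX_eq : site v sigmaX = weyl (Finsupp.single v 1) (Finsupp.single v 0) := by
    simpa [siteProd, chain] using siteProd_sigmaX [v]
  have sigmaZ_eq : site v sigmaZ = weyl (Finsupp.single v 0) (Finsupp.single v 1) := by
    simpa [siteProd, chain] using siteProd_sigmaZ [v]
  have sigmaX_mul_sigmaZ_eq :
      site v (sigmaX * sigmaZ) = weyl (Finsupp.single v 1) (Finsupp.single v 1) := by
    simpa [siteProd, chain] using siteProd_sigmaX_mul_siteProd_sigmaZ [v] [v]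
  have weyl_mem : ∀ i j, weyl (Finsupp.single v i) (Finsupp.single v j) ∈ Submodule.span ℂ
      (Set.range fun x : Fin 2 × Fin 2 => weyl (Finsupp.single v x.1) (Finsupp.single v x.2)) :=
    fun i j => Submodule.subset_span ⟨(i, j), rfl⟩
  rw [pauli_expansion]
  simp only [map_add, map_smul, one_eq, sigmaX_eq, sigmaZ_eq, sigmaX_mul_sigmaZ_eq]
  exact add_mem (add_mem (add_mem (Submodule.smul_mem _ _ (weyl_mem 0 0))
    (Submodule.smul_mem _ _ (weyl_mem 1 0))) (Submodule.smul_mem _ _ (weyl_mem 0 1)))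
    (Submodule.smul_mem _ _ (weyl_mem 1 1))

/-- The `*`-algebra of finite linear combinations of Weyl operators. -/
def weylSpan : StarSubalgebra ℂ QuasiLocal where
  __ := (Submodule.span ℂ (Set.range fun p : Config × Config => weyl p.1 p.2)).toSubalgebra
    (Submodule.subset_span ⟨0, weyl_zero⟩) fun A B hA hB => by
      induction hA, hB using Submodule.span_induction₂ with
      | mem_mem A B hA hB =>
        obtain ⟨p, rfl⟩ := hA
        obtain ⟨q, rfl⟩ := hB
        rw [weyl_mul_weyl]
        exact Submodule.smul_mem _ _ (Submodule.subset_span ⟨p + q, rfl⟩)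
      | zero_left | zero_right => simp only [zero_mul, mul_zero, zero_mem]
      | add_left _ _ _ _ _ _ h h' | add_right _ _ _ _ _ _ h h' =>
        simpa only [add_mul, mul_add] using add_mem h h'
      | smul_left r _ _ _ _ h | smul_right r _ _ _ _ h =>
        simpa only [smul_mul_assoc, mul_smul_comm] using Submodule.smul_mem _ r h
  star_mem' {A} hA := by
    refine (?_ : _ ≤ Submodule.comap (starLinearEquiv ℂ).toLinearMap (Submodule.span ℂ _)) hA
    rw [Submodule.span_le]
    rintro _ ⟨p, rfl⟩
    change star (weyl p.1 p.2) ∈ Submodule.span ℂ _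
    rw [star_weyl]
    exact Submodule.smul_mem _ _ (Submodule.subset_span ⟨p, rfl⟩)

theorem dense_weylSpan : Dense (weylSpan : Set QuasiLocal) := by
  have dense_strictlyLocal : Dense (strictlyLocalAlgebra Set.univ : Set QuasiLocal) := fun A =>
    show A ∈ localAlgebra Set.univ by rw [localAlgebra_univ]; trivial
  have strictlyLocal_le : strictlyLocalAlgebra Set.univ ≤ weylSpan := by
    refine StarAlgebra.adjoin_le ?_
    rintro _ ⟨v, -, M, rfl⟩
    refine Submodule.span_mono ?_ (site_mem_span_weyl v M)
    rintro _ ⟨x, rfl⟩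
    exact ⟨(_, _), rfl⟩
  exact dense_strictlyLocal.mono strictlyLocal_le

theorem eq_of_eq_on_weyl {E F : Type*} [TopologicalSpace E] [T2Space E] [AddCommMonoid E]
    [Module ℂ E] [FunLike F QuasiLocal E] [LinearMapClass F ℂ QuasiLocal E]
    [ContinuousMapClass F QuasiLocal E] {f g : F} (h : ∀ a b, f (weyl a b) = g (weyl a b)) :
    f = g := by
  refine DFunLike.coe_injective <|
    (map_continuous f).ext_on dense_weylSpan (map_continuous g) fun A hA => ?_
  refine LinearMap.eqOn_span (f := (f : QuasiLocal →ₗ[ℂ] E)) (g := (g : QuasiLocal →ₗ[ℂ] E)) ?_ hA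
  rintro _ ⟨p, rfl⟩
  exact h p.1 p.2

end WeylSpan

section Twist

variable (S T S' T' : Vertex → Fin 2)

/-- Conjugation by a Weyl operator, `A ↦ (XᶜZᵈ)* A XᶜZᵈ`. -/
def weylConj (c d : Config) : QuasiLocal →⋆ₐ[ℂ] QuasiLocal where
  toFun A := star (weyl c d) * A * weyl c d
  map_one' := by rw [mul_one, (weyl_mem_unitary c d).1]
  map_mul' A B := by
    rw [mul_assoc _ (weyl c d), ← mul_assoc (weyl c d), ← mul_assoc (weyl c d),
      (weyl_mem_unitary c d).2, one_mul]
    simp only [mul_assoc]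
  map_zero' := by rw [mul_zero, zero_mul]
  map_add' A B := by rw [mul_add, add_mul]
  commutes' r := by rw [← Algebra.commutes, mul_assoc, (weyl_mem_unitary c d).1, mul_one]
  map_star' A := by simp only [star_mul, star_star, mul_assoc]

theorem weylConj_weyl (a b c d : Config) :
    weylConj c d (weyl a b) = sign (symplectic c d a b) • weyl a b :=
  star_weyl_mul_weyl_mul_weyl a b c d

theorem exists_twist : ∃ τ : QuasiLocal →⋆ₐ[ℂ] QuasiLocal,
    ∀ a b, τ (weyl a b) = sign (symplectic S T a b) • weyl a b := by
  classical
  let restrict (R : Vertex → Fin 2) (D : Finset Vertex) : Config :=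
    Finsupp.indicator D fun v _ => R v
  have pairing_restrict : ∀ R (a : Config), ∀ᶠ D in atTop, pairing (restrict R D) a = pairing R a :=
    fun R a => by
      filter_upwards [eventually_ge_atTop a.support] with D hD
      exact pairing_congr fun v hv => Finsupp.indicator_of_mem (hD hv) _
  let conj (D : Finset Vertex) : QuasiLocal →⋆ₐ[ℂ] QuasiLocal :=
    weylConj (restrict S D) (restrict T D)
  have conj_weyl : ∀ a b, ∀ᶠ D in atTop,
      conj D (weyl a b) = sign (symplectic S T a b) • weyl a b := fun a b => by
    filter_upwards [pairing_restrict S b, pairing_restrict T a] with D hS hT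
    rw [symplectic, ← hS, ← hT]
    exact weylConj_weyl a b _ _
  obtain ⟨τ, hτ⟩ := exists_starAlgHom_tendsto conj dense_weylSpan fun A hA => by
    induction hA using Submodule.span_induction with
    | mem A hA =>
      obtain ⟨⟨a, b⟩, rfl⟩ := hA
      exact ⟨_, tendsto_const_nhds.congr' (EventuallyEq.symm (conj_weyl a b))⟩
    | zero => exact ⟨0, by simp only [map_zero, tendsto_const_nhds]⟩
    | add A B _ _ hA hB =>
      obtain ⟨A', hA⟩ := hA
      obtain ⟨B', hB⟩ := hB
      exact ⟨A' + B', by simpa only [map_add] using hA.add hB⟩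
    | smul r A _ hA =>
      obtain ⟨A', hA⟩ := hA
      exact ⟨r • A', by simpa only [map_smul] using hA.const_smul r⟩
  exact ⟨τ, fun a b => tendsto_nhds_unique (hτ _)
    (tendsto_const_nhds.congr' (EventuallyEq.symm (conj_weyl a b)))⟩

/-- Conjugation by the formal product of `σˣ` over the possibly infinite chain `S` and of `σᶻ` over
`T`: the endomorphism `ρ_γ^{ck}` of a string is of this form. -/
def twist : QuasiLocal →⋆ₐ[ℂ] QuasiLocal :=
  (exists_twist S T).choose

theorem twist_weyl (a b : Config) :
    twist S T (weyl a b) = sign (symplectic S T a b) • weyl a b :=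
  (exists_twist S T).choose_spec a b

theorem twist_zero : twist 0 0 = StarAlgHom.id ℂ QuasiLocal :=
  eq_of_eq_on_weyl fun a b => by simp [twist_weyl, symplectic]

theorem twist_comp_twist : (twist S T).comp (twist S' T') = twist (S + S') (T + T') :=
  eq_of_eq_on_weyl fun a b => by
    simp only [StarAlgHom.comp_apply, twist_weyl, map_smul, smul_smul, ← AddChar.map_add_eq_mul,
      symplectic, map_add, LinearMap.add_apply]
    congr 2
    abel

theorem twist_surjective : Function.Surjective (twist S T) := fun A => by
  refine ⟨twist S T A, ?_⟩
  rw [← StarAlgHom.comp_apply, twist_comp_twist, CharTwo.add_self_eq_zero, CharTwo.add_self_eq_zero,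
    twist_zero, StarAlgHom.coe_id, id]

theorem twist_coe (c d : Config) : twist c d = weylConj c d :=
  eq_of_eq_on_weyl fun a b => by rw [twist_weyl, weylConj_weyl]

variable {S T} in
theorem twist_eq_self_of_mem_localAlgebra {Λ : Set Vertex} (hS : ∀ v ∈ Λ, S v = 0)
    (hT : ∀ v ∈ Λ, T v = 0) {A : QuasiLocal} (hA : A ∈ localAlgebra Λ) : twist S T A = A := by
  have generators_fixed : strictlyLocalAlgebra Λ ≤
      StarAlgHom.equalizer (twist S T) (StarAlgHom.id ℂ QuasiLocal) := by
    refine StarAlgebra.adjoin_le ?_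
    rintro _ ⟨v, hv, M, rfl⟩
    refine LinearMap.eqOn_span (f := (twist S T : QuasiLocal →ₗ[ℂ] QuasiLocal)) (g := .id) ?_
      (site_mem_span_weyl v M)
    rintro _ ⟨x, rfl⟩
    simp [twist_weyl, symplectic, pairing_single, hS v hv, hT v hv]
  exact StarSubalgebra.topologicalClosure_minimal generators_fixed
    (isClosed_eq (map_continuous (twist S T)) continuous_id) hA

/-- The functional `ω` seen through a twist. -/
def twistState (ω : Functional) (S T : Vertex → Fin 2) : Functional :=
  ω.comp (.ofClass (twist S T))

variable (ω : Functional)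

theorem twistState_apply (A : QuasiLocal) : twistState ω S T A = ω (twist S T A) := rfl

theorem twistState_weyl (a b : Config) :
    twistState ω S T (weyl a b) = sign (symplectic S T a b) * ω (weyl a b) := by
  rw [twistState_apply, twist_weyl, map_smul, smul_eq_mul]

end Twist

section LocallyFinite

variable {ι : Type*} {c : ℕ → ι →₀ Fin 2}

/-- The sum of a sequence of finite chains, meaningful when each point lies on finitely many of
them. -/
def chainSum (c : ℕ → ι →₀ Fin 2) (v : ι) : Fin 2 :=
  ∑ᶠ j, c j v

theorem eventually_sum_range_apply_eq_chainSum {v : ι} (hc : {j | c j v ≠ 0}.Finite) :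
    ∀ᶠ n in atTop, (∑ j ∈ Finset.range n, c j) v = chainSum c v := by
  obtain ⟨N, hN⟩ := hc.bddAbove
  filter_upwards [eventually_gt_atTop N] with n hn
  rw [Finsupp.finsetSum_apply, chainSum, finsum_eq_sum_of_support_subset]
  exact fun j hj => Finset.mem_coe.2 (Finset.mem_range.2 ((hN hj).trans_lt hn))

theorem eventually_pairing_sum_range_eq (hc : ∀ v, {j | c j v ≠ 0}.Finite) (a : ι →₀ Fin 2) :
    ∀ᶠ n in atTop, pairing (∑ j ∈ Finset.range n, c j : ι →₀ Fin 2) a = pairing (chainSum c) a := by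
  have eventually_eq_on_support : ∀ᶠ n in atTop, ∀ v ∈ a.support,
      (∑ j ∈ Finset.range n, c j) v = chainSum c v :=
    (Filter.eventually_all_finset _).2 fun v _ => eventually_sum_range_apply_eq_chainSum (hc v)
  exact eventually_eq_on_support.mono fun n hn => pairing_congr hn

end LocallyFinite

section Strings

/-- The exponent of `σˣ` in a Pauli matrix, `σʸ` being `σˣσᶻ` up to a phase. -/
def Pauli.xPart : Pauli → Fin 2
  | .x => 1
  | .y => 1
  | .z => 0

/-- The exponent of `σᶻ` in a Pauli matrix. -/
def Pauli.zPart : Pauli → Fin 2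
  | .x => 0
  | .y => 1
  | .z => 1

theorem stringOp_eq_weyl (k : Pauli) (l : List Vertex) :
    stringOp k l = weyl (k.xPart • chain l) (k.zPart • chain l) := by
  cases k
  · simp only [stringOp, Pauli.xPart, Pauli.zPart, one_smul, zero_smul, siteProd_sigmaX]
  · simp only [stringOp, Pauli.xPart, Pauli.zPart, one_smul, siteProd_sigmaX_mul_siteProd_sigmaZ]
  · simp only [stringOp, Pauli.xPart, Pauli.zPart, one_smul, zero_smul, siteProd_sigmaZ]

variable {c : Color}

namespace HalfInfiniteString

variable (γ : HalfInfiniteString c)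

/-- The two ends of the `j`-th edge of a string. -/
def edgeChain (j : ℕ) : Config :=
  Finsupp.single (γ.vtx (2 * j)) 1 + Finsupp.single (γ.vtx (2 * j + 1)) 1

/-- The vertices of a string, counted modulo two. -/
def chain : Vertex → Fin 2 :=
  chainSum γ.edgeChain

theorem finite_edgeChain_apply_ne_zero (v : Vertex) : {j | γ.edgeChain j v ≠ 0}.Finite := by
  refine ((γ.finite_visits v).image (· / 2)).subset fun j hj => ?_
  by_contra not_visited
  have left_ne : γ.vtx (2 * j) ≠ v := fun h => not_visited ⟨2 * j, h, by simp⟩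
  have right_ne : γ.vtx (2 * j + 1) ≠ v := fun h => not_visited ⟨2 * j + 1, h, by simp; omega⟩
  exact hj (by simp [edgeChain, left_ne, right_ne])

theorem chain_trunc_succ (n : ℕ) :
    ColorCode.chain (γ.trunc (n + 1)) = ∑ j ∈ Finset.range n, γ.edgeChain j := by
  rw [ColorCode.chain, trunc, List.map_map, Nat.add_sub_cancel]
  induction n with
  | zero => simp
  | succ n ih =>
    rw [Finset.sum_range_succ, ← ih, mul_add_one, List.range_succ, List.range_succ]
    simp [edgeChain]

theorem endo_weyl (k : Pauli) (a b : Config) : γ.endo k (weyl a b) =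
    sign (symplectic (k.xPart • γ.chain) (k.zPart • γ.chain) a b) • weyl a b := by
  refine tendsto_nhds_unique ((γ.tendsto_conj k _).comp (tendsto_add_atTop_nat 1))
    (tendsto_const_nhds.congr' ?_)
  filter_upwards [eventually_pairing_sum_range_eq γ.finite_edgeChain_apply_ne_zero a,
    eventually_pairing_sum_range_eq γ.finite_edgeChain_apply_ne_zero b] with n ha hb
  rw [Function.comp_apply, conj, stringOp_eq_weyl, star_weyl_mul_weyl_mul_weyl, chain_trunc_succ]
  simp only [symplectic, Finsupp.coe_smul, map_smul, LinearMap.smul_apply, ha, hb, chain]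

theorem endo_eq_twist (k : Pauli) :
    γ.endo k = twist (k.xPart • γ.chain) (k.zPart • γ.chain) :=
  eq_of_eq_on_weyl fun a b => by rw [endo_weyl, twist_weyl]

end HalfInfiniteString

theorem stringState_eq_twistState (ω : Functional) (γ : HalfInfiniteString c) (k : Pauli) :
    stringState ω γ k = twistState ω (k.xPart • γ.chain) (k.zPart • γ.chain) := by
  rw [stringState, γ.endo_eq_twist, twistState]

end Strings

section Faces

instance : DecidableEq Face := Classical.decEq Face

/-- The boundary of a face as a chain. -/
def Face.bd (f : Face) : Config := chain f.boundary

/-- The stabilizers violated by a chain: its pairings with the boundaries of the faces. -/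
def syndrome : (Vertex → Fin 2) →ₗ[Fin 2] (Face → Fin 2) :=
  LinearMap.pi fun f => pairing.flip f.bd

/-- The chains generated by the boundaries of faces. -/
def faceSpan : Submodule (Fin 2) Config := Submodule.span (Fin 2) (Set.range Face.bd)

theorem syndrome_apply (S : Vertex → Fin 2) (f : Face) : syndrome S f = pairing S f.bd := rfl

theorem Face.bd_mem_faceSpan (f : Face) : f.bd ∈ faceSpan := Submodule.subset_span ⟨f, rfl⟩

theorem Face.mem_boundary_iff (f : Face) (v : Vertex) : v ∈ f.boundary ↔
    (f.col ≤ v.1 ∧ v.1 ≤ f.col + 2) ∧ (f.row ≤ v.2 ∧ v.2 ≤ f.row + 1) := by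
  obtain ⟨x, y⟩ := v
  simp only [Face.boundary, List.mem_cons, Prod.mk.injEq, List.not_mem_nil, or_false]
  omega

theorem Face.bd_apply (f : Face) (v : Vertex) : f.bd v = if v ∈ f.boundary then 1 else 0 := by
  rw [Face.bd, chain_apply, List.Nodup.count (by simp [Face.boundary])]
  split_ifs <;> rfl

theorem syndrome_single (v : Vertex) (x : Fin 2) (f : Face) :
    syndrome (Finsupp.single v x) f = x * f.bd v := by
  rw [syndrome_apply, pairing_comm, pairing_single]

theorem syndrome_eq_sum (S : Vertex → Fin 2) (f : Face) : syndrome S f =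
    (S (f.col, f.row) + S (f.col + 1, f.row) + S (f.col + 2, f.row)) +
      (S (f.col, f.row + 1) + S (f.col + 1, f.row + 1) + S (f.col + 2, f.row + 1)) := by
  rw [syndrome_apply, Face.bd, pairing_chain]
  simp [Face.boundary, add_assoc]

theorem IsEdge.symm {v w : Vertex} (h : IsEdge v w) : IsEdge w v := by
  simp only [IsEdge, Int.odd_iff] at *
  omega

theorem IsEdge.face_unique {v w : Vertex} (h : IsEdge v w) {f g : Face} (hvf : v ∈ f.boundary)
    (hwf : w ∉ f.boundary) (hvg : v ∈ g.boundary) (hwg : w ∉ g.boundary) : f = g := by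
  obtain ⟨a, b, hf⟩ := f
  obtain ⟨a', b', hg⟩ := g
  have odd_f := hf
  have odd_g := hg
  simp only [Face.mem_boundary_iff, IsEdge, Int.odd_iff, Face.mk.injEq] at *
  omega

theorem Connects.syndrome_eq {v w : Vertex} {f g : Face} (h : Connects v w f g) :
    syndrome (Finsupp.single v 1 + Finsupp.single w 1 : Config) =
      Pi.single f 1 + Pi.single g 1 := by
  have f_ne_g : f ≠ g := fun e => h.not_mem_left (e ▸ h.mem_left)
  ext1 k
  rw [Finsupp.coe_add, map_add, Pi.add_apply, Pi.add_apply, syndrome_single, syndrome_single,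
    one_mul, one_mul, Face.bd_apply, Face.bd_apply]
  by_cases hf : k = f
  · subst hf
    simp [h.mem_left, h.not_mem_right, f_ne_g]
  by_cases hg : k = g
  · subst hg
    simp [h.mem_right, h.not_mem_left, f_ne_g]
  have both_or_none : v ∈ k.boundary ↔ w ∈ k.boundary := by
    constructor <;> intro mem <;> by_contra not_mem
    · exact hf (h.edge.face_unique mem not_mem h.mem_left h.not_mem_right)
    · exact hg (h.edge.symm.face_unique mem not_mem h.mem_right h.not_mem_left)
  simp [both_or_none, hf, hg, CharTwo.add_self_eq_zero]

theorem Face.syndrome_bd (f : Face) : syndrome f.bd = 0 := by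
  ext1 g
  have hf := f.odd
  have hg := g.odd
  simp only [Int.odd_iff] at hf hg
  let colInd (x : ℤ) : Fin 2 := if f.col ≤ x ∧ x ≤ f.col + 2 then 1 else 0
  let rowInd (y : ℤ) : Fin 2 := if f.row ≤ y ∧ y ≤ f.row + 1 then 1 else 0
  have bd_eq_mul : ∀ x y, f.bd (x, y) = colInd x * rowInd y := fun x y => by
    simp only [bd_apply, mem_boundary_iff, colInd, rowInd, ite_and, ite_mul, one_mul, zero_mul]
  have common_even : colInd g.col + colInd (g.col + 1) + colInd (g.col + 2) = 0 ∨
      rowInd g.row + rowInd (g.row + 1) = 0 := by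
    by_cases adjacent : g.row = f.row + 1 ∨ g.row + 1 = f.row
    · left
      simp only [colInd]
      split_ifs <;> first | rfl | omega
    · right
      simp only [rowInd]
      split_ifs <;> first | rfl | omega
  rw [syndrome_eq_sum]
  simp only [bd_eq_mul, ← add_mul, ← mul_add]
  rcases common_even with h | h <;> simp [h]

theorem syndrome_eq_zero_of_mem_faceSpan {a : Config} (ha : a ∈ faceSpan) : syndrome a = 0 := by
  induction ha using Submodule.span_induction with
  | mem a ha =>
    obtain ⟨f, rfl⟩ := ha
    exact f.syndrome_bd
  | zero => exact map_zero syndrome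
  | add a b _ _ ha hb => rw [Finsupp.coe_add, map_add, ha, hb, add_zero]
  | smul x a _ ha => rw [Finsupp.coe_smul, map_smul, ha, smul_zero]

end Faces

section Cycles

theorem eq_zero_of_syndrome_eq_zero_of_row {a : Config} (ha : syndrome a = 0) {y : ℤ}
    (hy : ∀ v, a v ≠ 0 → v.2 = y) : a = 0 := by
  have off_row : ∀ x z, z ≠ y → a (x, z) = 0 := fun x z hz => by_contra fun h => hz (hy _ h)
  have consecutive : ∀ x, a (x, y) + a (x + 1, y) + a (x + 2, y) = 0 := fun x => by
    rcases Int.even_or_odd (x + y) with even | odd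
    · have := congrFun ha ⟨x, y - 1, by rw [← add_sub_assoc]; exact even.sub_odd odd_one⟩
      simpa [syndrome_eq_sum, off_row] using this
    · simpa [syndrome_eq_sum, off_row] using congrFun ha ⟨x, y, odd⟩
  by_contra ne_zero
  obtain ⟨⟨x, z⟩, mem, leftmost⟩ := Finset.exists_min_image a.support Prod.fst
    (Finsupp.support_nonempty_iff.2 ne_zero)
  have apply_ne_zero := Finsupp.mem_support_iff.1 mem
  obtain rfl : z = y := hy _ apply_ne_zero
  have left_eq_zero : ∀ x' < x, a (x', z) = 0 := fun x' hx' => by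
    by_contra h
    exact (leftmost _ (Finsupp.mem_support_iff.2 h)).not_gt hx'
  refine apply_ne_zero ?_
  simpa [left_eq_zero, show x - 2 + 1 < x by omega] using consecutive (x - 2)

/-- The brick whose upper side has its midpoint at `(x, y)`. -/
def faceBelow (x y : ℤ) (h : Odd (x + y)) : Face :=
  ⟨x - 1, y - 1, by rw [Int.odd_iff] at *; omega⟩

theorem exists_faceSpan_eq_on_odd_row (a : Config) (y : ℤ) : ∃ b ∈ faceSpan,
    (∀ x, Odd (x + y) → b (x, y) = a (x, y)) ∧ ∀ v, b v ≠ 0 → v.2 = y ∨ v.2 = y - 1 := by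
  induction a using Finsupp.induction_linear with
  | zero => exact ⟨0, zero_mem _, by simp, by simp⟩
  | add a a' ih ih' =>
    obtain ⟨b, hb, row, supp⟩ := ih
    obtain ⟨b', hb', row', supp'⟩ := ih'
    refine ⟨b + b', add_mem hb hb', fun x hx => by simp [row x hx, row' x hx], fun v hv => ?_⟩
    by_contra! h
    exact hv (by simp [not_imp_comm.1 (supp v) (by tauto), not_imp_comm.1 (supp' v) (by tauto)])
  | single v j =>
    obtain ⟨x, z⟩ := v
    by_cases h : z = y ∧ Odd (x + y)
    · obtain ⟨rfl, odd⟩ := h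
      refine ⟨j • (faceBelow x z odd).bd, Submodule.smul_mem _ _ (Face.bd_mem_faceSpan _),
        fun x' odd' => ?_, fun v hv => ?_⟩
      · have mem_iff : (x', z) ∈ (faceBelow x z odd).boundary ↔ x = x' := by
          have := Int.odd_iff.1 odd
          have := Int.odd_iff.1 odd'
          simp only [Face.mem_boundary_iff, faceBelow]
          omega
        simp [Face.bd_apply, mem_iff, Finsupp.single_apply]
      · have mem : v ∈ (faceBelow x z odd).boundary := by
          by_contra h
          exact hv (by simp [Face.bd_apply, h])
        simp only [Face.mem_boundary_iff, faceBelow] at mem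
        omega
    · refine ⟨0, zero_mem _, fun x' odd' => (Finsupp.single_eq_of_ne ?_).symm, by simp⟩
      rintro ⟨⟩
      exact h ⟨rfl, odd'⟩

theorem top_row_eq_zero_of_syndrome_eq_zero {a : Config} {y : ℤ} (ha : syndrome a = 0)
    (above : ∀ x z, y < z → a (x, z) = 0) (odd_row : ∀ x, Odd (x + y) → a (x, y) = 0) (x : ℤ) :
    a (x, y) = 0 := by
  by_cases odd : Odd (x + y)
  · exact odd_row x odd
  · have odd_left : Odd (x - 1 + y) := by rw [Int.odd_iff] at *; omega
    have odd_right : Odd (x - 1 + 2 + y) := by rw [Int.odd_iff] at *; omega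
    simpa [syndrome_eq_sum, above, odd_row _ odd_left, odd_row _ odd_right] using
      congrFun ha ⟨x - 1, y, odd_left⟩

theorem mem_faceSpan_of_rows (n : ℕ) {a : Config} {y : ℤ} (ha : syndrome a = 0)
    (hy : ∀ v, a v ≠ 0 → y ≤ v.2 ∧ v.2 ≤ y + n) : a ∈ faceSpan := by
  induction n generalizing a with
  | zero =>
    have single_row : ∀ v, a v ≠ 0 → v.2 = y := fun v hv => by have := hy v hv; omega
    rw [eq_zero_of_syndrome_eq_zero_of_row ha single_row]
    exact zero_mem _
  | succ n ih =>
    obtain ⟨b, hb, odd_row, supp⟩ := exists_faceSpan_eq_on_odd_row a (y + n + 1)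
    have outside : ∀ x z, z < y ∨ y + n + 1 < z → (a + b) (x, z) = 0 := fun x z hz => by
      rw [Finsupp.add_apply, not_imp_comm.1 (hy (x, z)) (by push_cast; omega),
        not_imp_comm.1 (supp (x, z)) (by dsimp only; omega), add_zero]
    have cycle : syndrome (a + b : Config) = 0 := by
      rw [Finsupp.coe_add, map_add, ha, syndrome_eq_zero_of_mem_faceSpan hb, add_zero]
    have top_row : ∀ x, (a + b) (x, y + n + 1) = 0 :=
      top_row_eq_zero_of_syndrome_eq_zero cycle (fun x z hz => outside x z (.inr hz))
        fun x hx => by rw [Finsupp.add_apply, odd_row x hx, CharTwo.add_self_eq_zero]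
    have sum_mem : a + b ∈ faceSpan := ih cycle fun v hv => by
      have not_outside := mt (outside v.1 v.2) hv
      have not_top : v.2 ≠ y + n + 1 := fun h => hv (by rw [← top_row v.1, ← h])
      omega
    simpa only [add_assoc, chain_add_self, add_zero] using add_mem sum_mem hb

theorem mem_faceSpan_of_syndrome_eq_zero {a : Config} (ha : syndrome a = 0) : a ∈ faceSpan := by
  let B := a.support.sup fun v => v.2.natAbs
  refine mem_faceSpan_of_rows (2 * B) (y := -B) ha fun v hv => ?_
  have : v.2.natAbs ≤ B := Finset.le_sup (f := fun v : Vertex => v.2.natAbs)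
    (Finsupp.mem_support_iff.2 hv)
  push_cast
  omega

end Cycles

section Translations

/-- The vector of the plane with coordinates `p` in the lattice of color-preserving translations. -/
def colorShift : ℤ × ℤ →+ Vertex where
  toFun p := (3 * p.1, p.1 + 2 * p.2)
  map_zero' := rfl
  map_add' p q := Prod.ext (by simp only [Prod.fst_add]; ring)
    (by simp only [Prod.fst_add, Prod.snd_add]; ring)

theorem colorShift_apply (p : ℤ × ℤ) : colorShift p = (3 * p.1, p.1 + 2 * p.2) := rfl

theorem colorShift_injective : Function.Injective colorShift := fun p q h => by
  simp only [colorShift_apply, Prod.mk.injEq] at h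
  ext <;> omega

theorem Face.ext_coords {f g : Face} (hcol : f.col = g.col) (hrow : f.row = g.row) : f = g := by
  cases f
  cases g
  simp_all

instance : AddAction (ℤ × ℤ) Face where
  vadd p f := ⟨f.col + (colorShift p).1, f.row + (colorShift p).2, by
    have := f.odd
    rw [Int.odd_iff, colorShift_apply] at *
    dsimp only
    omega⟩
  zero_vadd f := Face.ext_coords (add_zero _) (add_zero _)
  add_vadd p q f := Face.ext_coords (by
      change f.col + (colorShift (p + q)).1 = f.col + (colorShift q).1 + (colorShift p).1
      rw [map_add, Prod.fst_add, add_assoc, add_comm (colorShift q).1])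
    (by
      change f.row + (colorShift (p + q)).2 = f.row + (colorShift q).2 + (colorShift p).2
      rw [map_add, Prod.snd_add, add_assoc, add_comm (colorShift q).2])

theorem Face.vadd_col (p : ℤ × ℤ) (f : Face) : (p +ᵥ f).col = f.col + 3 * p.1 := rfl

theorem Face.vadd_row (p : ℤ × ℤ) (f : Face) : (p +ᵥ f).row = f.row + (p.1 + 2 * p.2) := rfl

theorem Face.vadd_right_injective (f : Face) : Function.Injective fun p : ℤ × ℤ => p +ᵥ f :=
  fun p q h => by
    have col_eq := congrArg Face.col h
    have row_eq := congrArg Face.row h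
    simp only [vadd_col, vadd_row] at col_eq row_eq
    ext <;> omega

theorem Face.color_eq_iff {f g : Face} : f.color = g.color ↔ f.col % 3 = g.col % 3 := by
  refine ⟨fun h => ?_, fun h => by rw [color, color, h]⟩
  unfold color at h
  split_ifs at h <;> omega

theorem Face.color_vadd (p : ℤ × ℤ) (f : Face) : (p +ᵥ f).color = f.color := by
  rw [color_eq_iff, vadd_col, Int.add_mul_emod_self_left]

theorem Face.exists_vadd_eq {f g : Face} (h : f.color = g.color) :
    ∃ p : ℤ × ℤ, p +ᵥ f = g := by
  rw [color_eq_iff] at h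
  have hf := f.odd
  have hg := g.odd
  rw [Int.odd_iff] at hf hg
  refine ⟨((g.col - f.col) / 3, (g.row - f.row - (g.col - f.col) / 3) / 2), ext_coords ?_ ?_⟩
  · rw [vadd_col]
    omega
  · rw [vadd_row]
    omega

/-- The translate of a finite chain by the vector `d`. -/
def translate (d : Vertex) : Config →ₗ[Fin 2] Config :=
  (Finsupp.domLCongr (R := Fin 2) (M := Fin 2) (Equiv.addRight d)).toLinearMap

theorem translate_apply (d : Vertex) (a : Config) (v : Vertex) : translate d a v = a (v - d) := rfl

theorem syndrome_translate (p : ℤ × ℤ) (a : Config) (f : Face) :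
    syndrome (translate (colorShift p) a) (p +ᵥ f) = syndrome a f := by
  simp only [syndrome_eq_sum, translate_apply, Face.vadd_col, Face.vadd_row, colorShift_apply,
    Prod.mk_sub_mk, add_right_comm f.col, add_right_comm f.row, add_sub_cancel_right]

theorem syndrome_translate_eq {a : Config} {f g : Face}
    (ha : syndrome a = Pi.single f 1 + Pi.single g 1) (p : ℤ × ℤ) :
    syndrome (translate (colorShift p) a) = Pi.single (p +ᵥ f) 1 + Pi.single (p +ᵥ g) 1 := by
  ext1 k
  obtain ⟨k, rfl⟩ := AddAction.surjective p k
  rw [syndrome_translate, ha]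
  simp only [Pi.add_apply, Pi.single_apply, vadd_left_cancel_iff]

end Translations

section Joined

/-- Two faces are joined if some finite chain violates exactly their stabilizers. -/
def Joined (f g : Face) : Prop :=
  ∃ a : Config, syndrome a = Pi.single f 1 + Pi.single g 1

instance : Nonempty Face := ⟨⟨0, 1, by decide⟩⟩

theorem Joined.refl (f : Face) : Joined f f :=
  ⟨0, by rw [CharTwo.add_self_eq_zero, Finsupp.coe_zero, map_zero]⟩

theorem Joined.symm {f g : Face} : Joined f g → Joined g f :=
  fun ⟨a, ha⟩ => ⟨a, by rw [ha, add_comm]⟩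

theorem Joined.trans {f g h : Face} : Joined f g → Joined g h → Joined f h :=
  fun ⟨a, ha⟩ ⟨b, hb⟩ => ⟨a + b, by
    rw [Finsupp.coe_add, map_add, ha, hb, add_assoc, ← add_assoc (Pi.single g 1),
      CharTwo.add_self_eq_zero, zero_add]⟩

theorem Connects.joined {v w : Vertex} {f g : Face} (h : Connects v w f g) : Joined f g :=
  ⟨_, h.syndrome_eq⟩

theorem Face.connects_up (f : Face) :
    Connects (f.col + 1, f.row + 1) (f.col + 1, f.row + 2) f (((0, 1) : ℤ × ℤ) +ᵥ f) := by
  have := Int.odd_iff.1 f.odd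
  constructor <;>
    simp only [mem_boundary_iff, IsEdge, vadd_col, vadd_row, Int.odd_iff, true_and] <;> omega

theorem Face.connects_right (f : Face) :
    Connects (f.col + 2, f.row + 1) (f.col + 3, f.row + 1) f (((1, 0) : ℤ × ℤ) +ᵥ f) := by
  have := Int.odd_iff.1 f.odd
  constructor <;>
    simp only [mem_boundary_iff, IsEdge, vadd_col, vadd_row, Int.odd_iff, true_and] <;> omega

theorem joined_vadd (p : ℤ × ℤ) (f : Face) : Joined f (p +ᵥ f) := by
  let G : AddSubgroup (ℤ × ℤ) :=
    { carrier := {p | ∀ f : Face, Joined f (p +ᵥ f)}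
      zero_mem' := fun f => by rw [zero_vadd]; exact .refl f
      add_mem' := fun {p q} hp hq f => by rw [add_vadd]; exact (hq f).trans (hp _)
      neg_mem' := fun {p} hp f => by simpa using (hp (-p +ᵥ f)).symm }
  have right_mem : (1, 0) ∈ G := fun f => f.connects_right.joined
  have up_mem : (0, 1) ∈ G := fun f => f.connects_up.joined
  have mem : p.1 • ((1, 0) : ℤ × ℤ) + p.2 • ((0, 1) : ℤ × ℤ) ∈ G :=
    add_mem (zsmul_mem right_mem _) (zsmul_mem up_mem _)
  simpa using mem f

theorem joined_of_color_eq {f g : Face} (h : f.color = g.color) : Joined f g := by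
  obtain ⟨p, rfl⟩ := Face.exists_vadd_eq h
  exact joined_vadd p f

end Joined

section Charges

theorem syndrome_chainSum {c : ℕ → Config} {f : ℕ → Face} (hc : ∀ v, {j | c j v ≠ 0}.Finite)
    (h : ∀ j, syndrome (c j) = Pi.single (f j) 1 + Pi.single (f (j + 1)) 1)
    (hf : Tendsto f atTop cofinite) : syndrome (chainSum c) = Pi.single (f 0) 1 := by
  have telescope : ∀ n, syndrome (∑ j ∈ Finset.range n, c j : Config) =
      Pi.single (f 0) 1 + Pi.single (f n) 1 := fun n => by
    induction n with
    | zero =>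
      rw [Finset.range_zero, Finset.sum_empty, Finsupp.coe_zero, map_zero,
        CharTwo.add_self_eq_zero]
    | succ n ih =>
      rw [Finset.sum_range_succ, Finsupp.coe_add, map_add, ih, h, add_assoc,
        ← add_assoc (Pi.single (f n) 1), CharTwo.add_self_eq_zero, zero_add]
  ext1 g
  obtain ⟨n, hn, hne⟩ := ((eventually_pairing_sum_range_eq hc g.bd).and
    (hf.eventually (eventually_cofinite_ne g))).exists
  rw [syndrome_apply, ← hn, ← syndrome_apply, telescope, Pi.add_apply,
    Pi.single_eq_of_ne hne.symm, add_zero]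

theorem HalfInfiniteString.tendsto_face {c : Color} (γ : HalfInfiniteString c) :
    Tendsto γ.face atTop cofinite := by
  rw [← Nat.cofinite_eq_atTop]
  refine Tendsto.cofinite_of_finite_preimage_singleton fun g => ?_
  have visits_finite : (⋃ v ∈ g.boundary, (2 * ·) ⁻¹' {n | γ.vtx n = v}).Finite :=
    g.boundary.finite_toSet.biUnion fun v _ =>
      (γ.finite_visits v).preimage (mul_right_injective₀ two_ne_zero).injOn
  refine visits_finite.subset ?_
  rintro i rfl
  exact Set.mem_biUnion (γ.connects i).mem_left rfl

theorem HalfInfiniteString.syndrome_chain {c : Color} (γ : HalfInfiniteString c) :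
    syndrome γ.chain = Pi.single (γ.face 0) 1 :=
  syndrome_chainSum γ.finite_edgeChain_apply_ne_zero (fun j => (γ.connects j).syndrome_eq)
    γ.tendsto_face

theorem exists_halfInfiniteString (f : Face) :
    ∃ γ : HalfInfiniteString f.color, γ.face 0 = f := by
  refine ⟨{ face := fun i => ((0, (i : ℤ)) : ℤ × ℤ) +ᵥ f
            vtx := fun j => (f.col + 1, f.row + j + 1)
            color_face := fun i => Face.color_vadd _ f
            connects := fun i => ?_
            finite_visits := fun v => ?_ }, zero_vadd _ f⟩
  · have next : ((0, ((i + 1 : ℕ) : ℤ)) : ℤ × ℤ) +ᵥ f =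
        ((0, 1) : ℤ × ℤ) +ᵥ ((0, (i : ℤ)) : ℤ × ℤ) +ᵥ f := by
      rw [vadd_vadd, Prod.mk_add_mk, zero_add, Nat.cast_succ, add_comm]
    rw [next]
    convert (((0, (i : ℤ)) : ℤ × ℤ) +ᵥ f).connects_up using 2 <;>
      simp only [Face.vadd_col, Face.vadd_row] <;> push_cast <;> ring
  · refine Set.Subsingleton.finite fun m hm n hn => ?_
    simpa using congrArg Prod.snd (hm.trans hn.symm)

/-- The chains `a`, `a + d`, `a + 2d`, … follow one another and escape to infinity. -/
theorem exists_charge_of_eventually_mem {Λ : Set Vertex} {p : ℤ × ℤ} (hp : p ≠ 0)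
    (hΛ : ∀ v, ∀ᶠ n : ℕ in atTop, v + colorShift (n • p) ∈ Λ) (f : Face) :
    ∃ g : Face, g.color = f.color ∧ ∃ S : Vertex → Fin 2,
      syndrome S = Pi.single g 1 ∧ ∀ v ∉ Λ, S v = 0 := by
  obtain ⟨a, ha⟩ := joined_vadd p f
  obtain ⟨N, hN⟩ := eventually_atTop.1
    ((Filter.eventually_all_finset a.support).2 fun v _ => hΛ v)
  have smul_injective : Function.Injective fun j : ℕ => (N + j) • p :=
    (injective_nsmul_iff_not_isOfFinAddOrder.2
      (not_isOfFinAddOrder_of_isAddTorsionFree hp)).comp (add_right_injective N)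
  let c (j : ℕ) : Config := translate (colorShift ((N + j) • p)) a
  refine ⟨N • p +ᵥ f, Face.color_vadd _ f, chainSum c, ?_, fun v hv => ?_⟩
  · refine syndrome_chainSum (f := fun j => (N + j) • p +ᵥ f) (fun v => ?_) (fun j => ?_) ?_
    · refine (a.support.finite_toSet.preimage (f := fun j => v - colorShift ((N + j) • p))
        (sub_right_injective.comp (colorShift_injective.comp smul_injective)).injOn).subset ?_
      exact fun j hj => Finsupp.mem_support_iff.2 hj
    · have next : (N + (j + 1)) • p +ᵥ f = (N + j) • p +ᵥ (p +ᵥ f) := by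
        rw [vadd_vadd, ← add_assoc, succ_nsmul]
      rw [next]
      exact syndrome_translate_eq ha _
    · rw [← Nat.cofinite_eq_atTop]
      exact (f.vadd_right_injective.comp smul_injective).tendsto_cofinite
  · refine finsum_eq_zero_of_forall_eq_zero fun j => ?_
    by_contra h
    have mem := hN (N + j) (Nat.le_add_right N j) (v - colorShift ((N + j) • p))
      (Finsupp.mem_support_iff.2 h)
    rw [sub_add_cancel] at mem
    exact hv mem

end Charges

section Loops

theorem existsUnique_face (v : Vertex) (c : Color) :
    ∃! f : Face, f.color = c ∧ v ∈ f.boundary := by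
  obtain ⟨f₀, rfl⟩ : ∃ f₀ : Face, f₀.color = c := by
    cases c
    · exact ⟨⟨0, 1, by decide⟩, rfl⟩
    · exact ⟨⟨1, 0, by decide⟩, rfl⟩
    · exact ⟨⟨2, 1, by decide⟩, rfl⟩
  simp only [Face.color_eq_iff, Face.mem_boundary_iff]
  obtain ⟨a, ha, hav⟩ : ∃ a : ℤ, a % 3 = f₀.col % 3 ∧ a ≤ v.1 ∧ v.1 ≤ a + 2 :=
    ⟨v.1 - (v.1 - f₀.col) % 3, by omega, by omega, by omega⟩
  obtain ⟨b, hb, hbv⟩ : ∃ b : ℤ, Odd (a + b) ∧ b ≤ v.2 ∧ v.2 ≤ b + 1 := by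
    rcases Int.even_or_odd (a + v.2) with h | h
    · exact ⟨v.2 - 1, by rw [← add_sub_assoc]; exact h.sub_odd odd_one, by omega, by omega⟩
    · exact ⟨v.2, h, by omega, by omega⟩
  refine ⟨⟨a, b, hb⟩, ⟨ha, hav, hbv⟩, fun g ⟨hg, hgcol, hgrow⟩ => ?_⟩
  have hg_odd := g.odd
  rw [Int.odd_iff] at *
  refine Face.ext_coords ?_ ?_ <;> dsimp only <;> omega

instance : DecidableEq Color := Classical.decEq Color

/-- The boundary of the union of the faces of color `c` in a finite set of faces. -/
def colorSum (D : Finset Face) (c : Color) : Config := ∑ f ∈ D with f.color = c, f.bd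

theorem colorSum_mem_faceSpan (D : Finset Face) (c : Color) : colorSum D c ∈ faceSpan :=
  sum_mem fun f _ => f.bd_mem_faceSpan

theorem pairing_colorSum {S : Vertex → Fin 2} {f : Face} (hS : syndrome S = Pi.single f 1)
    {D : Finset Face} (hf : f ∈ D) (c : Color) :
    pairing S (colorSum D c) = if f.color = c then 1 else 0 := by
  simp only [colorSum, map_sum, ← syndrome_apply, hS, Finset.sum_pi_single', Finset.mem_filter,
    hf, true_and]

theorem exists_colorSum_eq_one (F : Finset Vertex) (D₀ : Finset Face) :
    ∃ D ⊇ D₀, ∀ v ∈ F, ∀ c, colorSum D c v = 1 := by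
  choose faceAt faceAt_spec faceAt_unique using existsUnique_face
  refine ⟨D₀ ∪ F.biUnion fun v => {faceAt v .r, faceAt v .g, faceAt v .b},
    Finset.subset_union_left, fun v hv c => ?_⟩
  have faceAt_mem : faceAt v c ∈ ({faceAt v .r, faceAt v .g, faceAt v .b} : Finset Face) := by
    cases c <;> simp
  rw [colorSum, Finsupp.finsetSum_apply, Finset.sum_eq_single_of_mem (faceAt v c)]
  · rw [Face.bd_apply, if_pos (faceAt_spec v c).2]
  · exact Finset.mem_filter.2 ⟨Finset.mem_union_right _ (Finset.mem_biUnion.2 ⟨v, hv, faceAt_mem⟩),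
      (faceAt_spec v c).1⟩
  · intro g hg hne
    have not_mem : v ∉ g.boundary := fun mem =>
      hne (faceAt_unique v c g ⟨(Finset.mem_filter.1 hg).2, mem⟩)
    rw [Face.bd_apply, if_neg not_mem]

/-- The parity of the number of colors among `c₁` and `c₂` that equal `c`. -/
def colorParity (c₁ c₂ c : Color) : Fin 2 := (if c = c₁ then 1 else 0) + (if c = c₂ then 1 else 0)

/-- Two colors cover a large region twice, so the sum of their faces is a loop around it. -/
theorem exists_loop (F : Finset Vertex) (D₀ : Finset Face) (c₁ c₂ : Color) :
    ∃ a ∈ faceSpan, (∀ v ∈ F, a v = 0) ∧ ∀ f ∈ D₀, ∀ S : Vertex → Fin 2,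
      syndrome S = Pi.single f 1 → pairing S a = colorParity c₁ c₂ f.color := by
  obtain ⟨D, hD₀, hD⟩ := exists_colorSum_eq_one F D₀
  refine ⟨colorSum D c₁ + colorSum D c₂,
    add_mem (colorSum_mem_faceSpan D c₁) (colorSum_mem_faceSpan D c₂),
    fun v hv => ?_, fun f hf S hS => ?_⟩
  · rw [Finsupp.add_apply, hD v hv, hD v hv, CharTwo.add_self_eq_zero]
  · rw [map_add, pairing_colorSum hS (hD₀ hf), pairing_colorSum hS (hD₀ hf), colorParity]

end Loops

section Cones

theorem eventually_add_natCast_smul_mem {E : Type*} [AddCommGroup E] [Module ℝ E]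
    [TopologicalSpace E] [ContinuousAdd E] [ContinuousSMul ℝ E] {G : Set E} (hG : IsOpen G)
    (hsmul : ∀ r : ℝ, 0 < r → ∀ x ∈ G, r • x ∈ G) (x : E) {y : E} (hy : y ∈ G) :
    ∀ᶠ n : ℕ in atTop, x + (n : ℝ) • y ∈ G := by
  have tendsto_y : Tendsto (fun n : ℕ => (n : ℝ)⁻¹ • x + y) atTop (𝓝 y) := by
    simpa using ((tendsto_inv_atTop_nhds_zero_nat (𝕜 := ℝ)).smul_const x).add_const y
  filter_upwards [tendsto_y.eventually (hG.mem_nhds hy), eventually_gt_atTop 0] with n hn n_pos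
  have n_pos' : (0 : ℝ) < n := Nat.cast_pos.2 n_pos
  simpa only [smul_add, smul_inv_smul₀ n_pos'.ne'] using hsmul n n_pos' _ hn

theorem position_add (v w : Vertex) : position (v + w) = position v + position w := by
  ext i
  fin_cases i <;> simp [position]

theorem position_nsmul (n : ℕ) (v : Vertex) : position (n • v) = (n : ℝ) • position v := by
  ext i
  fin_cases i <;> simp [position]

theorem denseRange_ratPosition :
    DenseRange fun q : ℚ × ℚ => (!₂[(q.1 : ℝ), (q.2 : ℝ)] : EuclideanSpace ℝ (Fin 2)) := by
  have surjective_pair : Function.Surjective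
      fun q : ℝ × ℝ => (!₂[q.1, q.2] : EuclideanSpace ℝ (Fin 2)) := fun x =>
    ⟨(x 0, x 1), by ext i; fin_cases i <;> rfl⟩
  refine surjective_pair.denseRange.comp (Rat.denseRange_cast.prodMap Rat.denseRange_cast) ?_
  refine (PiLp.continuous_toLp 2 _).comp (continuous_pi fun i => ?_)
  fin_cases i
  · exact continuous_fst
  · exact continuous_snd

theorem exists_position_mem {G : Set (EuclideanSpace ℝ (Fin 2))} (hG : IsOpen G)
    (hne : G.Nonempty) (hsmul : ∀ r : ℝ, 0 < r → ∀ x ∈ G, r • x ∈ G) :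
    ∃ u : Vertex, position u ∈ G := by
  obtain ⟨⟨q, r⟩, hqr⟩ := denseRange_ratPosition.exists_mem_open hG hne
  have clear_denominators : position (q.num * r.den, r.num * q.den) =
      ((q.den : ℝ) * r.den) • (!₂[(q : ℝ), (r : ℝ)] : EuclideanSpace ℝ (Fin 2)) := by
    have hq : (q.den : ℝ) * q = q.num := by exact_mod_cast Rat.den_mul_eq_num q
    have hr : (r.den : ℝ) * r = r.num := by exact_mod_cast Rat.den_mul_eq_num r
    ext i
    fin_cases i
    · simp [position, ← hq]
      ring
    · simp [position, ← hr]
      ring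
  refine ⟨(q.num * r.den, r.num * q.den), ?_⟩
  rw [clear_denominators]
  exact hsmul _ (mul_pos (Nat.cast_pos.2 q.den_pos) (Nat.cast_pos.2 r.den_pos)) _ hqr

theorem IsCone.exists_direction {Λ : Set Vertex} (hΛ : IsCone Λ) :
    ∃ p : ℤ × ℤ, p ≠ 0 ∧ ∀ v, ∀ᶠ n : ℕ in atTop, v + colorShift (n • p) ∈ Λ := by
  obtain ⟨x₀, a, θ, ha, hθ_pos, hθ_lt, rfl⟩ := hΛ
  let G : Set (EuclideanSpace ℝ (Fin 2)) := {x | ‖x‖ * Real.cos θ < ⟪x, a⟫_ℝ}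
  have isOpen_G : IsOpen G := isOpen_lt (by fun_prop) (by fun_prop)
  have smul_mem_G : ∀ r : ℝ, 0 < r → ∀ x ∈ G, r • x ∈ G := fun r hr x hx => by
    simp only [G, Set.mem_ofPred_eq, norm_smul, real_inner_smul_left, Real.norm_of_nonneg hr.le,
      mul_assoc] at hx ⊢
    exact mul_lt_mul_of_pos_left hx hr
  have a_mem_G : a ∈ G := by
    have cos_lt_one : Real.cos θ < 1 := by
      simpa using Real.cos_lt_cos_of_nonneg_of_le_pi le_rfl hθ_lt.le hθ_pos
    simpa [G, ha] using cos_lt_one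
  obtain ⟨u, hu⟩ := exists_position_mem isOpen_G ⟨a, a_mem_G⟩ smul_mem_G
  let p : ℤ × ℤ := (2 * u.1, 3 * u.2 - u.1)
  have colorShift_p : colorShift p = 6 • u := by
    rw [colorShift_apply]
    ext <;> simp [p] <;> ring
  have position_p_mem : position (colorShift p) ∈ G := by
    rw [colorShift_p, position_nsmul]
    exact smul_mem_G _ (by norm_num) _ hu
  refine ⟨p, ?_, fun v => ?_⟩
  · intro hp
    have position_zero : position 0 = 0 := by simpa using position_nsmul 0 0
    simp [hp, position_zero, G] at position_p_mem
  · filter_upwards [eventually_add_natCast_smul_mem isOpen_G smul_mem_G (position v - x₀)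
      position_p_mem] with n hn
    change position (v + colorShift (n • p)) - x₀ ∈ G
    rwa [map_nsmul, position_add, position_nsmul, add_sub_right_comm]

end Cones

section Vacuum

variable {ω ω' : Functional} {a b : Config}

theorem Face.K_eq_weyl (f : Face) : f.K = weyl f.bd 0 := siteProd_sigmaX _

theorem Face.J_eq_weyl (f : Face) : f.J = weyl 0 f.bd := siteProd_sigmaZ _

theorem pairing_eq_zero_of_mem_faceSpan {S : Vertex → Fin 2} (hS : syndrome S = 0)
    (ha : a ∈ faceSpan) : pairing S a = 0 := by
  have faceSpan_le : faceSpan ≤ LinearMap.ker (pairing S) := by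
    rw [faceSpan, Submodule.span_le]
    rintro _ ⟨f, rfl⟩
    exact congrFun hS f
  exact faceSpan_le ha

theorem apply_weyl_add_eq_one {c d : Config} (hω : ω 1 = 1) (hab : ω (weyl a b) = 1)
    (hcd : ω (weyl c d) = 1) (h : pairing b c = 0) : ω (weyl (a + c) (b + d)) = 1 := by
  have mul_eq : weyl (a + c) (b + d) = weyl a b * weyl c d := by
    rw [weyl_mul_weyl, h, AddChar.map_zero_eq_one, one_smul]
  rw [mul_eq, map_mul_of_norm_apply_eq_one hω (weyl_mem_unitary c d) (by rw [hcd, norm_one]), hab,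
    hcd, one_mul]

theorem IsVacuum.apply_weyl_of_mem (hω : IsVacuum ω) (ha : a ∈ faceSpan) (hb : b ∈ faceSpan) :
    ω (weyl a b) = 1 := by
  have apply_eq_one : ∀ c ∈ faceSpan, ω (weyl c 0) = 1 ∧ ω (weyl 0 c) = 1 := fun c hc => by
    induction hc using Submodule.span_induction with
    | mem c hc =>
      obtain ⟨f, rfl⟩ := hc
      rw [← f.K_eq_weyl, ← f.J_eq_weyl]
      exact hω.2 f
    | zero => exact ⟨weyl_zero ▸ hω.1, weyl_zero ▸ hω.1⟩
    | add c d _ _ hc hd =>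
      constructor
      · simpa using apply_weyl_add_eq_one hω.1 hc.1 hd.1 (by simp)
      · simpa using apply_weyl_add_eq_one hω.1 hc.2 hd.2 (by simp)
    | smul x c _ hc =>
      fin_cases x
      · simpa [weyl_zero] using hω.1
      · simpa using hc
  simpa using apply_weyl_add_eq_one hω.1 (apply_eq_one a ha).1 (apply_eq_one b hb).2 (by simp)

theorem IsVacuum.apply_weyl_eq_zero {c d : Config} (hω : IsVacuum ω) (hc : c ∈ faceSpan)
    (hd : d ∈ faceSpan) (h : symplectic c d a b ≠ 0) : ω (weyl a b) = 0 := by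
  have conj := map_star_mul_mul_of_norm_apply_eq_one hω.1 (weyl_mem_unitary c d)
    (by simp [hω.apply_weyl_of_mem hc hd]) (weyl a b)
  rw [star_weyl_mul_weyl_mul_weyl, Fin.eq_one_of_ne_zero _ h, map_smul, sign_one, neg_smul,
    one_smul] at conj
  exact CharZero.neg_eq_self_iff.1 conj

open scoped Classical in
theorem IsVacuum.apply_weyl (hω : IsVacuum ω) (a b : Config) :
    ω (weyl a b) = if a ∈ faceSpan ∧ b ∈ faceSpan then 1 else 0 := by
  have violated : ∀ c : Config, c ∉ faceSpan → ∃ f : Face, pairing ⇑f.bd c ≠ 0 := fun c hc => by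
    by_contra! h
    exact hc (mem_faceSpan_of_syndrome_eq_zero (funext fun f => (pairing_comm c f.bd).trans (h f)))
  split_ifs with h
  · exact hω.apply_weyl_of_mem h.1 h.2
  · rcases not_and_or.1 h with ha | hb
    · obtain ⟨f, hf⟩ := violated a ha
      exact hω.apply_weyl_eq_zero (zero_mem _) f.bd_mem_faceSpan (by simpa [symplectic] using hf)
    · obtain ⟨f, hf⟩ := violated b hb
      exact hω.apply_weyl_eq_zero f.bd_mem_faceSpan (zero_mem _) (by simpa [symplectic] using hf)

theorem IsVacuum.eq (hω : IsVacuum ω) (hω' : IsVacuum ω') : ω = ω' :=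
  eq_of_eq_on_weyl fun a b => by rw [hω.apply_weyl, hω'.apply_weyl]

theorem IsVacuum.twistState_congr (hω : IsVacuum ω) {S T S' T' : Vertex → Fin 2}
    (hS : syndrome S = syndrome S') (hT : syndrome T = syndrome T') :
    twistState ω S T = twistState ω S' T' := by
  have pairing_eq : ∀ {R R' : Vertex → Fin 2}, syndrome R = syndrome R' →
      ∀ c ∈ faceSpan, pairing R c = pairing R' c := fun {R R'} h c hc =>
    sub_eq_zero.1 <| by
      rw [← LinearMap.sub_apply, ← map_sub]
      exact pairing_eq_zero_of_mem_faceSpan (by rw [map_sub, h, sub_self]) hc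
  refine eq_of_eq_on_weyl fun a b => ?_
  rw [twistState_weyl, twistState_weyl, hω.apply_weyl]
  split_ifs with h
  · rw [symplectic, symplectic, pairing_eq hS b h.2, pairing_eq hT a h.1]
  · rw [mul_zero, mul_zero]

end Vacuum

section Existence

theorem exists_fixed_unit_vector (G : Submodule (Fin 2) Config) [Finite G] : ∃ ψ : RefSpace,
    ‖ψ‖ = 1 ∧ ∀ a ∈ G, ∀ b, (∀ c ∈ G, pairing c b = 0) → toOp (weyl a b) ψ = ψ := by
  classical
  let χ : RefSpace := ∑ g ∈ (G : Set Config).toFinite.toFinset, lp.single 2 g (1 : ℂ)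
  have χ_apply : ∀ s, χ s = if s ∈ G then 1 else 0 := fun s => by
    rw [lp.coeFn_sum, Finset.sum_apply]
    simp only [lp.single_apply, Finset.sum_pi_single, Set.Finite.mem_toFinset, SetLike.mem_coe]
  have χ_ne_zero : χ ≠ 0 := fun h => by simpa [h] using χ_apply 0
  refine ⟨((‖χ‖⁻¹ : ℝ) : ℂ) • χ, by simp [norm_smul, χ_ne_zero], fun a ha b hb => ?_⟩
  rw [map_smul]
  congr 1
  ext s
  rw [toOp_weyl_apply, χ_apply, χ_apply, add_mem_cancel_right ha]
  split_ifs with hs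
  · rw [hb _ (add_mem hs ha), AddChar.map_zero_eq_one, one_mul]
  · rw [mul_zero]

theorem exists_isVacuum : ∃ ω : Functional, IsVacuum ω := by
  let G (D : Finset Face) : Submodule (Fin 2) Config := .span (Fin 2) (Face.bd '' D)
  have finite_G : ∀ D, Finite (G D) := fun D => by
    have := Module.Finite.span_of_finite (Fin 2) (D.finite_toSet.image Face.bd)
    exact Module.finite_of_finite (Fin 2)
  choose ψ norm_ψ hψ using fun D => exists_fixed_unit_vector (G D)
  obtain ⟨ω, hω⟩ := exists_positiveLinearMap_tendsto (Ultrafilter.of atTop)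
    (fun D => vectorFunctional toOp (ψ D)) fun A =>
      ⟨‖A‖, fun D => norm_vectorFunctional_apply_le toOp (norm_ψ D) A⟩
  have apply_eq_one : ∀ {A}, (∀ᶠ D in atTop, toOp A (ψ D) = ψ D) → ω A = 1 := fun {A} h => by
    refine tendsto_nhds_unique (hω A) (tendsto_const_nhds.congr' ?_)
    filter_upwards [Ultrafilter.of_le atTop h] with D hD
    rw [vectorFunctional_apply, hD, inner_self_eq_norm_sq_to_K, norm_ψ]
    norm_num
  refine ⟨ω, apply_eq_one (.of_forall fun D => ?_), fun f => ⟨apply_eq_one ?_, apply_eq_one ?_⟩⟩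
  · rw [map_one, one_apply_eq_self]
  · filter_upwards [eventually_ge_atTop {f}] with D hD
    rw [f.K_eq_weyl]
    exact hψ D _ (Submodule.subset_span ⟨f, by simpa using hD, rfl⟩) 0 fun c _ => map_zero _
  · filter_upwards with D
    rw [f.J_eq_weyl]
    refine hψ D 0 (zero_mem _) _ fun c hc => ?_
    have hc' : c ∈ faceSpan := Submodule.span_mono (Set.image_subset_range _ _) hc
    exact congrFun (syndrome_eq_zero_of_mem_faceSpan hc') f

end Existence

section Transport

variable {ω : Functional} {S T S' : Vertex → Fin 2} {f f' : Face}

theorem equivalent_gns_twistState_add_coe (ω : Functional) (S T : Vertex → Fin 2) (c d : Config) :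
    Equivalent (gns (twistState ω (S + c) (T + d))) (gns (twistState ω S T)) :=
  exists_linearIsometryEquiv_gns_of_conj (weyl_mem_unitary c d) fun A => by
    rw [twistState_apply, ← twist_comp_twist, twist_coe]
    rfl

theorem IsVacuum.equivalent_gns_twistState (hω : IsVacuum ω) (hS : syndrome S = Pi.single f 1)
    (hS' : syndrome S' = Pi.single f' 1) (hf : f.color = f'.color) (x z : Fin 2) :
    Equivalent (gns (twistState ω (x • S) (z • S))) (gns (twistState ω (x • S') (z • S'))) := by
  obtain ⟨a, ha⟩ := joined_of_color_eq hf
  have syndrome_smul : ∀ y : Fin 2, syndrome (y • S) = syndrome (y • S' + ⇑(y • a)) := fun y => by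
    rw [Finsupp.coe_smul, ← smul_add, map_smul, map_smul, map_add, hS, hS', ha, add_left_comm,
      CharTwo.add_self_eq_zero, add_zero]
  rw [hω.twistState_congr (syndrome_smul x) (syndrome_smul z)]
  exact equivalent_gns_twistState_add_coe ω (x • S') (z • S') (x • a) (z • a)

theorem equivalent_gns_twistState_comp (ω : Functional) (S T : Vertex → Fin 2) :
    Equivalent (gns (twistState ω S T)) ((gns ω).comp (twist S T)) :=
  exists_linearIsometryEquiv_gns
    ((denseRange_gnsVector ω).comp (twist_surjective S T).denseRange
      ((map_continuous (gns ω)).clm_apply continuous_const))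
    fun A => inner_gnsVector ω (twist S T A)

theorem IsVacuum.satisfiesSuperselection (hω : IsVacuum ω) (hS : syndrome S = Pi.single f 1)
    (x z : Fin 2) : SatisfiesSuperselection ω (gns (twistState ω (x • S) (z • S))) := by
  intro Λ hΛ
  obtain ⟨p, hp, hpΛ⟩ := hΛ.exists_direction
  obtain ⟨g, hg, S', hS', S'_eq_zero⟩ := exists_charge_of_eventually_mem hp hpΛ f
  obtain ⟨U, hU⟩ := hω.equivalent_gns_twistState hS hS' hg.symm x z
  obtain ⟨V, hV⟩ := equivalent_gns_twistState_comp ω (x • S') (z • S')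
  have smul_eq_zero : ∀ y : Fin 2, ∀ v ∈ Λᶜ, (y • S') v = 0 := fun y v hv => by
    rw [Pi.smul_apply, S'_eq_zero v hv, smul_zero]
  refine ⟨U.trans V, fun A hA ξ => ?_⟩
  rw [LinearIsometryEquiv.trans_apply, LinearIsometryEquiv.trans_apply, hU, hV,
    StarAlgHom.comp_apply, twist_eq_self_of_mem_localAlgebra (smul_eq_zero x) (smul_eq_zero z) hA]

end Transport

section Classification

theorem weyl_commute {a b c d : Config} (h : symplectic c d a b = 0) :
    Commute (weyl a b) (weyl c d) := by
  rw [Commute, SemiconjBy, weyl_mul_comm, h, AddChar.map_zero_eq_one, one_smul]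

theorem exists_finset_commute_of_mem_weylSpan {A : QuasiLocal} (hA : A ∈ weylSpan) :
    ∃ F : Finset Vertex, ∀ a b : Config, (∀ v ∈ F, a v = 0) → (∀ v ∈ F, b v = 0) →
      Commute (weyl a b) A := by
  classical
  induction hA using Submodule.span_induction with
  | mem A hA =>
    obtain ⟨⟨c, d⟩, rfl⟩ := hA
    have pairing_eq_zero : ∀ {a c : Config}, (∀ v ∈ c.support, a v = 0) → pairing a c = 0 :=
      fun h => (pairing_congr (S' := 0) h).trans (by rw [map_zero, LinearMap.zero_apply])
    refine ⟨c.support ∪ d.support, fun a b ha hb => weyl_commute ?_⟩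
    rw [symplectic, pairing_comm c, pairing_comm d,
      pairing_eq_zero fun v hv => hb v (Finset.mem_union_left _ hv),
      pairing_eq_zero fun v hv => ha v (Finset.mem_union_right _ hv), add_zero]
  | zero => exact ⟨∅, fun a b _ _ => Commute.zero_right _⟩
  | add A B _ _ hA hB =>
    obtain ⟨F, hF⟩ := hA
    obtain ⟨G, hG⟩ := hB
    exact ⟨F ∪ G, fun a b ha hb =>
      (hF a b (fun v hv => ha v (Finset.mem_union_left _ hv))
        fun v hv => hb v (Finset.mem_union_left _ hv)).add_right
      (hG a b (fun v hv => ha v (Finset.mem_union_right _ hv))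
        fun v hv => hb v (Finset.mem_union_right _ hv))⟩
  | smul r A _ hA =>
    obtain ⟨F, hF⟩ := hA
    exact ⟨F, fun a b ha hb => (hF a b ha hb).smul_right r⟩

variable {ω : Functional} {S S' : Vertex → Fin 2} {f f' : Face}

/-- Loops arbitrarily far away commute with every given local observable but measure the charge, so
equivalent states carry the same charge. -/
theorem IsVacuum.mul_colorParity_eq (hω : IsVacuum ω) (hS : syndrome S = Pi.single f 1)
    (hS' : syndrome S' = Pi.single f' 1) {x z x' z' : Fin 2}
    (h : Equivalent (gns (twistState ω (x • S) (z • S)))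
      (gns (twistState ω (x' • S') (z' • S')))) (s t : Fin 2) (c₁ c₂ : Color) :
    (x * t + z * s) * colorParity c₁ c₂ f.color =
      (x' * t + z' * s) * colorParity c₁ c₂ f'.color := by
  have apply_one : ∀ R T, twistState ω R T 1 = 1 := fun R T => by
    rw [twistState_apply, map_one, hω.1]
  refine sign_injective <| eq_of_gns_equivalent_of_commute (apply_one _ _) (apply_one _ _) h
    dense_weylSpan (norm_sign _) (norm_sign _) fun A hA => ?_
  obtain ⟨F, hF⟩ := exists_finset_commute_of_mem_weylSpan hA
  obtain ⟨a, ha, haF, loop⟩ := exists_loop F {f, f'} c₁ c₂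
  have smul_eq_zero : ∀ y : Fin 2, ∀ v ∈ F, (y • a) v = 0 := fun y v hv => by
    rw [Finsupp.smul_apply, haF v hv, smul_zero]
  have apply_loop : ∀ {R g}, g ∈ ({f, f'} : Finset Face) → syndrome R = Pi.single g 1 → ∀ x z,
      twistState ω (x • R) (z • R) (weyl (s • a) (t • a)) =
        sign ((x * t + z * s) * colorParity c₁ c₂ g.color) := fun {R g} hg hR x z => by
    rw [twistState_weyl, hω.apply_weyl_of_mem (Submodule.smul_mem _ s ha)
      (Submodule.smul_mem _ t ha), mul_one, symplectic]
    simp only [map_smul, LinearMap.smul_apply, loop g hg R hR, smul_eq_mul]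
    congr 1
    ring
  exact ⟨_, weyl_mem_unitary (s • a) (t • a), hF _ _ (smul_eq_zero s) (smul_eq_zero t),
    apply_loop (by simp) hS x z, apply_loop (by simp) hS' x' z'⟩

theorem eq_of_mul_colorParity_eq {c c' : Color} {k k' : Pauli}
    (h : ∀ s t c₁ c₂, (k.xPart * t + k.zPart * s) * colorParity c₁ c₂ c =
      (k'.xPart * t + k'.zPart * s) * colorParity c₁ c₂ c') : (c, k) = (c', k') := by
  have hx_rg := h 0 1 .r .g
  have hx_rb := h 0 1 .r .b
  have hz_rg := h 1 0 .r .g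
  have hz_rb := h 1 0 .r .b
  cases k <;> cases k' <;> cases c <;> cases c' <;>
    simp [Pauli.xPart, Pauli.zPart, colorParity] at hx_rg hx_rb hz_rg hz_rb ⊢

theorem IsVacuum.stringState_equivalent_iff (hω : IsVacuum ω) {c c' : Color} {k k' : Pauli}
    (γ : HalfInfiniteString c) (γ' : HalfInfiniteString c') :
    Equivalent (gns (stringState ω γ k)) (gns (stringState ω γ' k')) ↔ (c, k) = (c', k') := by
  rw [stringState_eq_twistState, stringState_eq_twistState]
  constructor
  · intro h
    refine eq_of_mul_colorParity_eq fun s t c₁ c₂ => ?_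
    have parity_eq := hω.mul_colorParity_eq γ.syndrome_chain γ'.syndrome_chain h s t c₁ c₂
    rwa [γ.color_face 0, γ'.color_face 0] at parity_eq
  · rintro ⟨⟩
    exact hω.equivalent_gns_twistState γ.syndrome_chain γ'.syndrome_chain
      ((γ.color_face 0).trans (γ'.color_face 0).symm) _ _

theorem IsVacuum.stringState_eq (hω : IsVacuum ω) {c : Color} {γ γ' : HalfInfiniteString c}
    (h : γ.face 0 = γ'.face 0) (k : Pauli) : stringState ω γ k = stringState ω γ' k := by
  have syndrome_eq : syndrome γ.chain = syndrome γ'.chain := by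
    rw [γ.syndrome_chain, γ'.syndrome_chain, h]
  rw [stringState_eq_twistState, stringState_eq_twistState]
  exact hω.twistState_congr (by rw [map_smul, map_smul, syndrome_eq])
    (by rw [map_smul, map_smul, syndrome_eq])

end Classification

end
end ColorCode

theorem mainTheorem4 :
    -- the ground state exists and is unique
    (∃! ω₀ : ColorCode.Functional, ColorCode.IsVacuum ω₀) ∧
    ∀ ω₀ : ColorCode.Functional, ColorCode.IsVacuum ω₀ →
      -- each face is the start of a string, and the string state depends on that face only
      (∀ f : ColorCode.Face, ∃ γ : ColorCode.HalfInfiniteString f.color, γ.face 0 = f) ∧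
      (∀ (c : ColorCode.Color) (k : ColorCode.Pauli) (γ γ' : ColorCode.HalfInfiniteString c),
        γ.face 0 = γ'.face 0 →
          ColorCode.stringState ω₀ γ k = ColorCode.stringState ω₀ γ' k) ∧
      -- the superselection criterion
      (∀ (c : ColorCode.Color) (k : ColorCode.Pauli) (γ : ColorCode.HalfInfiniteString c),
        ColorCode.SatisfiesSuperselection ω₀ (ColorCode.gns (ColorCode.stringState ω₀ γ k))) ∧
      -- independence of the starting face
      (∀ (c : ColorCode.Color) (k : ColorCode.Pauli) (γ γ' : ColorCode.HalfInfiniteString c),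
        ColorCode.Equivalent (ColorCode.gns (ColorCode.stringState ω₀ γ k))
          (ColorCode.gns (ColorCode.stringState ω₀ γ' k))) ∧
      -- classification by the type
      (∀ (c c' : ColorCode.Color) (k k' : ColorCode.Pauli)
        (γ : ColorCode.HalfInfiniteString c) (γ' : ColorCode.HalfInfiniteString c'),
        ColorCode.Equivalent (ColorCode.gns (ColorCode.stringState ω₀ γ k))
          (ColorCode.gns (ColorCode.stringState ω₀ γ' k')) ↔ (c, k) = (c', k')) := by
  obtain ⟨ω, hω⟩ := ColorCode.exists_isVacuum
  refine ⟨⟨ω, hω, fun ω' hω' => hω'.eq hω⟩, fun ω₀ hω₀ => ⟨ColorCode.exists_halfInfiniteString,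
    fun c k γ γ' h => hω₀.stringState_eq h k, fun c k γ => ?_,
    fun c k γ γ' => (hω₀.stringState_equivalent_iff γ γ').2 rfl,
    fun c c' k k' γ γ' => hω₀.stringState_equivalent_iff γ γ'⟩⟩
  rw [ColorCode.stringState_eq_twistState]
  exact hω₀.satisfiesSuperselection γ.syndrome_chain k.xPart k.zPart
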